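/- Let $X$ be a connected smooth projective curve over $\mathbb{C}$ with generic point $\eta$ and function field $K$, let $x_0\in X$ be a closed point, $L$ a line bundle on $X$, $0<r_1<\dots<r_k<r$ integers ($k\ge 0$), and $\beta_1,\dots,\beta_k$ positive rational numbers with $\sum_i\beta_i<1$. Let $z$ be the least common denominator of the $\beta_i$ and $\delta_2:=1/z$. A *parabolic Hitchin pair* is a tuple $(E,\phi,\epsilon,V_\bullet)$ consisting of a vector bundle $E$ of rank $r$ on $X$, a homomorphism $\phi:E\to E\otimes L$, a number $\epsilon\in\mathbb{C}$, and a flag $V_1\subset\dots\subset V_k$ in the fibre $E|_{x_0}$ with $\dim V_i=r_i$ and $\phi|_{x_0}(V_i)\subset V_i\otimes L|_{x_0}$, such that $\phi\neq 0$ or $\epsilon\neq 0$. *Associated decorated swamp.* Let $N$ be a line bundle with inclusions $\iota_1:L\to N$ and $\iota_2:\mathcal{O}_X\to N$ (for instance $N=\mathcal{O}_X(l)$ with $l$ large). The pair defines the nontrivial homomorphism $(\tilde\phi,\tilde\epsilon):\operatorname{End}(E)^\vee\oplus\mathcal{O}_X\to N$, where $\tilde\phi$ is the composition $\operatorname{End}(E)^\vee\cong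 E^\vee\otimes E\xrightarrow{\mathrm{id}\otimes\phi}E^\vee\otimes E\otimes L\xrightarrow{\operatorname{tr}\otimes\iota_1}N$ and $\tilde\epsilon=\epsilon\,\iota_2$. The flag $V_\bullet$ spans the line $\bigotimes_i(\bigwedge^{r_i}V_i)^{\otimes z\beta_i}$ in $\bigotimes_i(\bigwedge^{r_i}E|_{x_0})^{\otimes z\beta_i}$; evaluation at a generator of this line is a functional $s$ on the dual space $\bigl(\bigotimes_i(\bigwedge^{r_i}E|_{x_0})^{\otimes z\beta_i}\bigr)^\vee$. *Stability.* A *weighted flag* of $E$ is a flag of subbundles $0\subsetneq E_1\subsetneq\dots\subsetneq E_m\subsetneq E$, $m\ge 1$, with weights $\alpha_j\in\mathbb{Q}_{>0}$; put $$M(E_\bullet,\alpha)=\sum_{j=1}^m\alpha_j\bigl(\deg(E)\operatorname{rk}(E_j)-\deg(E_j)\operatorname{rk}(E)\bigr).$$ With the flag one associates the weights $\gamma_i=\sum_{j}\alpha_j\operatorname{rk}(E_j)-\sum_{j\ge i}\alpha_j r$, $1\le i\le m+1$. They define ascending filtrations of $E_\eta$ and of $E|_{x_0}$, in which $E_i$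 (with $E_{m+1}=E$) is the step of weight $\gamma_i$, and hence induced filtrations of the dual, tensor and exterior product spaces built from them (weights change sign under duals and add under products; a trivial summand has weight $0$). For a filtration $F_\bullet$ of a vector space and a nonzero linear map $f$ from it to a line put $\mu(F_\bullet,f)=-\min\{c: f|_{F_c}\ne 0\}$. Let $\mu_1(E_\bullet,\alpha)$ be the value of $\mu$ for the restriction of $(\tilde\phi,\tilde\epsilon)$ to $\eta$, and $\mu_2(E_\bullet,\alpha)$ its value for $s$. The pair is called *semistable* (respectively *stable*) if for every weighted flag $(E_\bullet,\alpha)$ of $E$ there is $c_1\in\mathbb{Q}_{>0}$ such that for all rational $\delta_1\ge c_1$ $$M(E_\bullet,\alpha)+\delta_1\mu_1(E_\bullet,\alpha)+\delta_2\mu_2(E_\bullet,\alpha)\ \ge 0\quad(\text{respectively }>0).$$ For a subbundle $F\subset E$ let $\operatorname{pardeg}_\beta(F)=\deg(F)+\sum_{i=1}^k\beta_i\dim(F|_{x_0}\cap V_i)$. Call $\phi$ *nilpotent* if for some $n$ the $n$-fold iterate $E\to E\otimes L^{\otimes n}$ vanishes, and $F$ *$\phi$-invariant* if $\phi(F)\subset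 F\otimes L$. **Proposition.** A parabolic Hitchin pair $(E,\phi,\epsilon,V_\bullet)$ is semistable (respectively stable) if and only if both of the following hold: 1. if $\epsilon=0$, then $\phi$ is not nilpotent; 2. every $\phi$-invariant subbundle $F$ of $E$ with $0<\operatorname{rk}F<r$ satisfies $$\frac{\operatorname{pardeg}_\beta(F)}{\operatorname{rk}(F)}\ \le\ \frac{\operatorname{pardeg}_\beta(E)}{\operatorname{rk}(E)}\qquad(\text{respectively }<).$$ -/

import Mathlib

open CategoryTheory AlgebraicGeometry TensorProduct Module

namespace ParHitchin

noncomputable section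

/-! ### Sheaves of modules, stalks, fibres -/

/-- The stalk of an `O_X`-module at a point. -/
abbrev Stalk {X : Scheme.{0}} (M : X.Modules) (x : X) : Type :=
  ↑(TopCat.Presheaf.stalk M.presheaf x)

instance stalkModule {X : Scheme.{0}} (M : X.Modules) (x : X) :
    Module (X.presheaf.stalk x) (Stalk M x) :=
  PresheafOfModules.instModuleCarrierStalkCommRingCatCarrierAbPresheafOpensCarrier
    (R := X.presheaf) M.val x

/-- The germ at `x` of a section over an open neighbourhood of `x`. -/
def germ {X : Scheme.{0}} (M : X.Modules) {U : X.Opens} (x : X) (hx : x ∈ U) (s : Γ(M, U)) :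
    Stalk M x :=
  TopCat.Presheaf.germ M.presheaf U x hx s

lemma germ_smul {X : Scheme.{0}} (M : X.Modules) {U : X.Opens} (x : X) (hx : x ∈ U)
    (a : Γ(X, U)) (s : Γ(M, U)) :
    germ M x hx (a • s) = X.presheaf.germ U x hx a • germ M x hx s :=
  PresheafOfModules.germ_smul (R := X.presheaf) M.val x U hx a s

lemma germ_sum {X : Scheme.{0}} (M : X.Modules) {U : X.Opens} (x : X) (hx : x ∈ U)
    {ι : Type*} (t : Finset ι) (s : ι → Γ(M, U)) :
    germ M x hx (∑ i ∈ t, s i) = ∑ i ∈ t, germ M x hx (s i) :=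
  map_sum (TopCat.Presheaf.germ M.presheaf U x hx).hom s t

lemma exists_germ {X : Scheme.{0}} (M : X.Modules) (x : X) (s : Stalk M x) :
    ∃ (U : X.Opens) (hx : x ∈ U) (t : Γ(M, U)), germ M x hx t = s :=
  TopCat.Presheaf.exists_germ_eq M.presheaf s

lemma germ_res {X : Scheme.{0}} (M : X.Modules) {U V : X.Opens} (h : V ≤ U) (x : X)
    (hx : x ∈ V) (s : Γ(M, U)) :
    germ M x hx (M.presheaf.map (homOfLE h).op s) = germ M x (h hx) s :=
  TopCat.Presheaf.germ_res_apply M.presheaf (homOfLE h) x hx s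

lemma germ_eq_nhd {X : Scheme.{0}} (M : X.Modules) {U : X.Opens} (x : X) (hx : x ∈ U)
    (s t : Γ(M, U)) (h : germ M x hx s = germ M x hx t) :
    ∃ (V : X.Opens) (_ : x ∈ V) (hVU : V ≤ U), ∀ (y : X) (hy : y ∈ V),
      germ M y (hVU hy) s = germ M y (hVU hy) t := by
  obtain ⟨W, hW, i, j, e⟩ := TopCat.Presheaf.germ_eq M.presheaf x hx hx s t h
  refine ⟨W, hW, i.le, fun y hy => ?_⟩
  rw [← germ_res M i.le y hy s, ← germ_res M i.le y hy t]
  exact congrArg (germ M y hy) e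

/-- The map of stalks `M_y → M_x` when `x` is a generization of `y`. -/
def specialize {X : Scheme.{0}} (M : X.Modules) {x y : X} (h : x ⤳ y) :
    Stalk M y →+ Stalk M x :=
  (TopCat.Presheaf.stalkSpecializes M.presheaf h).hom

lemma specialize_germ {X : Scheme.{0}} (M : X.Modules) {x y : X} (h : x ⤳ y) {U : X.Opens}
    (hy : y ∈ U) (s : Γ(M, U)) :
    specialize M h (germ M y hy s) = germ M x (h.mem_open U.2 hy) s :=
  TopCat.Presheaf.germ_stalkSpecializes_apply M.presheaf hy h s

lemma specialize_smul {X : Scheme.{0}} (M : X.Modules) {x y : X} (h : x ⤳ y)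
    (a : X.presheaf.stalk y) (s : Stalk M y) :
    specialize M h (a • s) = X.presheaf.stalkSpecializes h a • specialize M h s := by
  obtain ⟨U, hU, t, rfl⟩ := exists_germ M y s
  obtain ⟨V, hV, b, rfl⟩ := TopCat.Presheaf.exists_germ_eq X.presheaf a
  have hW : y ∈ U ⊓ V := ⟨hU, hV⟩
  rw [← germ_res M (inf_le_left : U ⊓ V ≤ U) y hW t,
    ← TopCat.Presheaf.germ_res_apply X.presheaf (homOfLE (inf_le_right : U ⊓ V ≤ V)) y hW b,
    ← germ_smul, specialize_germ, specialize_germ, germ_smul]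
  congr 1
  exact (TopCat.Presheaf.germ_stalkSpecializes_apply X.presheaf hW h _).symm

/-- The map of stalks induced by a morphism of `O_X`-modules. -/
def stalkMap {X : Scheme.{0}} {M N : X.Modules} (g : M ⟶ N) (x : X) :
    Stalk M x →ₗ[X.presheaf.stalk x] Stalk N x where
  toFun := (TopCat.Presheaf.stalkFunctor Ab x).map g.mapPresheaf
  map_add' := map_add ((TopCat.Presheaf.stalkFunctor Ab x).map g.mapPresheaf).hom
  map_smul' a s := by
    obtain ⟨U, hU, t, rfl⟩ := exists_germ M x s
    obtain ⟨V, hV, b, rfl⟩ := TopCat.Presheaf.exists_germ_eq X.presheaf a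
    have hW : x ∈ U ⊓ V := ⟨hU, hV⟩
    rw [← germ_res M (inf_le_left : U ⊓ V ≤ U) x hW t,
      ← TopCat.Presheaf.germ_res_apply X.presheaf (homOfLE (inf_le_right : U ⊓ V ≤ V)) x hW b,
      ← germ_smul]
    have key : ∀ s : Γ(M, U ⊓ V), (TopCat.Presheaf.stalkFunctor Ab x).map g.mapPresheaf
        (germ M x hW s) = germ N x hW (g.app (U ⊓ V) s) := fun s =>
      TopCat.Presheaf.stalkFunctor_map_germ_apply (U ⊓ V) x hW g.mapPresheaf s
    rw [key, key, Scheme.Modules.Hom.app_smul, germ_smul]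
    rfl

lemma stalkMap_germ {X : Scheme.{0}} {M N : X.Modules} (g : M ⟶ N) {U : X.Opens} (x : X)
    (hx : x ∈ U) (s : Γ(M, U)) :
    stalkMap g x (germ M x hx s) = germ N x hx (g.app U s) :=
  TopCat.Presheaf.stalkFunctor_map_germ_apply U x hx g.mapPresheaf s

lemma stalkMap_injective {X : Scheme.{0}} {M N : X.Modules} (g : M ⟶ N) [Mono g] (x : X) :
    Function.Injective (stalkMap g x) := by
  refine TopCat.Presheaf.stalkFunctor_map_injective_of_app_injective (C := Ab)
    (f := g.mapPresheaf) ?_ x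
  intro U
  have : Mono ((Scheme.Modules.toPresheaf X).map g) := inferInstance
  have h2 : Mono (((Scheme.Modules.toPresheaf X).map g).app (Opposite.op U)) := inferInstance
  exact (AddCommGrpCat.mono_iff_injective _).1 h2

/-- The residue field `κ(x)`. -/
abbrev Kappa {X : Scheme.{0}} (x : X) : Type := IsLocalRing.ResidueField (X.presheaf.stalk x)

/-- The fibre `M|_{x} = κ(x) ⊗ M_x`. -/
abbrev Fibre {X : Scheme.{0}} (M : X.Modules) (x : X) : Type :=
  Kappa x ⊗[X.presheaf.stalk x] Stalk M x

/-- The structure sheaf as a module over itself. -/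
abbrev structureModule (X : Scheme.{0}) : X.Modules := SheafOfModules.unit X.ringCatSheaf

/-! ### Vector bundles and subbundles -/

/-- Sections `e_1, …, e_n` over `U` form a frame of `M` over `U`, i.e. define an isomorphism
`O_U^n ≅ M|_U`: their germs are a basis of every stalk. -/
structure IsFrame {X : Scheme.{0}} (M : X.Modules) {U : X.Opens} {n : ℕ}
    (e : Fin n → Γ(M, U)) : Prop where
  linearIndependent : ∀ (x : X) (hx : x ∈ U),
    LinearIndependent (X.presheaf.stalk x) (fun i => germ M x hx (e i))
  span_eq_top : ∀ (x : X) (hx : x ∈ U),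
    Submodule.span (X.presheaf.stalk x) (Set.range (fun i => germ M x hx (e i))) = ⊤

/-- The basis of the stalk given by a frame. -/
def IsFrame.basis {X : Scheme.{0}} {M : X.Modules} {U : X.Opens} {n : ℕ}
    {e : Fin n → Γ(M, U)} (he : IsFrame M e) (x : X) (hx : x ∈ U) :
    Basis (Fin n) (X.presheaf.stalk x) (Stalk M x) :=
  Basis.mk (he.linearIndependent x hx) (he.span_eq_top x hx).ge

/-- A vector bundle of rank `r`: a locally free `O_X`-module of constant rank `r`. -/
structure VectorBundle (X : Scheme.{0}) (r : ℕ) where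
  sheaf : X.Modules
  exists_frame : ∀ x : X, ∃ (U : X.Opens) (_ : x ∈ U) (e : Fin r → Γ(sheaf, U)), IsFrame sheaf e

/-- A subbundle `F ⊆ E`: a subsheaf, given by its stalks `F_x ⊆ E_x`, which is locally
generated by the first `rank` members of a local frame of `E`.  (Equivalently: a locally free
subsheaf with locally free quotient.) -/
structure Subbundle {X : Scheme.{0}} {r : ℕ} (E : VectorBundle X r) where
  rank : ℕ
  rank_le : rank ≤ r
  stalk : ∀ x : X, Submodule (X.presheaf.stalk x) (Stalk E.sheaf x)
  locally_spanned : ∀ x : X, ∃ (U : X.Opens) (_ : x ∈ U) (e : Fin r → Γ(E.sheaf, U)),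
    IsFrame E.sheaf e ∧ ∀ (y : X) (hy : y ∈ U), stalk y = Submodule.span (X.presheaf.stalk y)
      (Set.range (fun i : Fin rank => germ E.sheaf y hy (e (Fin.castLE rank_le i))))

/-- `E` as a subbundle of itself. -/
def Subbundle.whole {X : Scheme.{0}} {r : ℕ} (E : VectorBundle X r) : Subbundle E where
  rank := r
  rank_le := le_rfl
  stalk _ := ⊤
  locally_spanned x := by
    obtain ⟨U, hU, e, he⟩ := E.exists_frame x
    exact ⟨U, hU, e, he, fun y hy => (he.span_eq_top y hy).symm⟩

lemma Subbundle.nonempty_basis {X : Scheme.{0}} {r : ℕ} {E : VectorBundle X r} (F : Subbundle E)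
    (x : X) : Nonempty (Basis (Fin F.rank) (X.presheaf.stalk x) (F.stalk x)) := by
  obtain ⟨U, hU, e, he, h⟩ := F.locally_spanned x
  have hli := (he.linearIndependent x hU).comp _ (Fin.castLE_injective F.rank_le)
  exact ⟨(Basis.span hli).map (LinearEquiv.ofEq _ _ (h x hU).symm)⟩

lemma Subbundle.specialize_mem {X : Scheme.{0}} {r : ℕ} {E : VectorBundle X r} (F : Subbundle E)
    {x y : X} (h : x ⤳ y) {s : Stalk E.sheaf y} (hs : s ∈ F.stalk y) :
    specialize E.sheaf h s ∈ F.stalk x := by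
  obtain ⟨U, hU, e, -, hF⟩ := F.locally_spanned y
  rw [hF y hU] at hs
  have hx : x ∈ U := h.mem_open U.2 hU
  induction hs using Submodule.span_induction with
  | mem s hs =>
    obtain ⟨i, rfl⟩ := hs
    rw [specialize_germ, hF x hx]
    exact Submodule.subset_span ⟨i, rfl⟩
  | zero => rw [map_zero]; exact zero_mem _
  | add s t _ _ hs ht => rw [map_add]; exact add_mem hs ht
  | smul a s _ hs => rw [specialize_smul]; exact Submodule.smul_mem _ _ hs

/-- The fibre `F|_{x}`, as a subspace of `E|_{x}`. -/
def Subbundle.fibre {X : Scheme.{0}} {r : ℕ} {E : VectorBundle X r} (F : Subbundle E) (x : X) :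
    Submodule (Kappa x) (Fibre E.sheaf x) :=
  (F.stalk x).baseChange (Kappa x)

/-- The restriction map from the stalk `F_x` to the generic fibre of `F`. -/
def Subbundle.toGeneric {X : Scheme.{0}} [IsIntegral X] {r : ℕ} {E : VectorBundle X r}
    (F : Subbundle E) (x : X) (s : F.stalk x) : F.stalk (genericPoint X) :=
  ⟨specialize E.sheaf (genericPoint_specializes x) s.1, F.specialize_mem _ s.2⟩

/-- A chosen basis of the stalk `F_x`. -/
def Subbundle.stalkBasis {X : Scheme.{0}} {r : ℕ} {E : VectorBundle X r} (F : Subbundle E)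
    (x : X) : Basis (Fin F.rank) (X.presheaf.stalk x) (F.stalk x) :=
  (F.nonempty_basis x).some

/-- The degree of `F`, i.e. the degree of the divisor of a nonzero rational section of `det F`.
The rational section is `b_1 ∧ ⋯ ∧ b_s` for a basis `b` of the generic fibre; if `e` is a
basis of the stalk `F_x`, then `e_1 ∧ ⋯ ∧ e_s = det_b(e) • b_1 ∧ ⋯ ∧ b_s`, so the order of the
section at `x` is `- ord_x (det_b e)`.  (The base field is algebraically closed in the
application, so all closed points have degree one; `ord` vanishes at the generic point.) -/
def Subbundle.degree {X : Scheme.{0}} [IsIntegral X] [IsLocallyNoetherian X] {r : ℕ}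
    {E : VectorBundle X r} (F : Subbundle E) : ℤ :=
  - ∑ᶠ x : X, X.ord ((F.stalkBasis (genericPoint X)).det
      (fun i => F.toGeneric x (F.stalkBasis x i))) x

/-! ### Smooth projective curves -/

attribute [local instance] MvPolynomial.gradedAlgebra in
/-- Projective `n`-space over the complex numbers. -/
def projectiveSpace (n : ℕ) : Scheme.{0} :=
  Proj (MvPolynomial.homogeneousSubmodule (Fin (n + 1)) ℂ)

attribute [local instance] MvPolynomial.gradedAlgebra in
/-- The structure morphism of projective space. -/
def projectiveSpaceToSpec (n : ℕ) : projectiveSpace n ⟶ Spec (CommRingCat.of ℂ) :=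
  Proj.toSpecZero (MvPolynomial.homogeneousSubmodule (Fin (n + 1)) ℂ) ≫
    Spec.map (CommRingCat.ofHom
      (algebraMap ℂ (MvPolynomial.homogeneousSubmodule (Fin (n + 1)) ℂ 0)))

/-- A (connected) smooth projective curve over the complex numbers. -/
structure Curve where
  X : Scheme.{0}
  str : X ⟶ Spec (CommRingCat.of ℂ)
  integral : IsIntegral X
  smooth : SmoothOfRelativeDimension 1 str
  projective : ∃ (n : ℕ) (i : X ⟶ projectiveSpace n),
    IsClosedImmersion i ∧ i ≫ projectiveSpaceToSpec n = str

instance (C : Curve) : IsIntegral C.X := C.integral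

instance (C : Curve) : IsLocallyNoetherian C.X :=
  have := C.smooth
  have : Smooth C.str := SmoothOfRelativeDimension.smooth 1 C.str
  LocallyOfFiniteType.isLocallyNoetherian C.str

/-- Complex numbers as constant functions on the curve. -/
def Curve.const (C : Curve) : ℂ →+* Γ(C.X, ⊤) :=
  C.str.appTop.hom.comp (Scheme.ΓSpecIso (CommRingCat.of ℂ)).inv.hom

/-! ### Twisted endomorphisms -/

/-- A morphism of `O_X`-modules `E → E ⊗ L`.  The sheaf `E ⊗ L` has stalks `E_x ⊗ L_x`, and its
sections are the families of elements of the stalks which are locally of the form `∑ a_i ⊗ b_i`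
with sections `a_i` of `E` and `b_i` of `L`.  A morphism is thus a family of linear maps of
stalks taking germs of sections of `E` to germs of sections of `E ⊗ L`. -/
structure TwistedEnd {X : Scheme.{0}} (E L : X.Modules) where
  map : ∀ x : X, Stalk E x →ₗ[X.presheaf.stalk x] Stalk E x ⊗[X.presheaf.stalk x] Stalk L x
  locally_section : ∀ (U : X.Opens) (s : Γ(E, U)) (x : X) (_ : x ∈ U),
    ∃ (V : X.Opens) (_ : x ∈ V) (hVU : V ≤ U) (n : ℕ) (a : Fin n → Γ(E, V)) (b : Fin n → Γ(L, V)),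
      ∀ (y : X) (hy : y ∈ V),
        map y (germ E y (hVU hy) s) = ∑ i, germ E y hy (a i) ⊗ₜ germ L y hy (b i)

/-- The induced map of fibres `E|_{x} → E|_{x} ⊗ L|_{x}`. -/
def TwistedEnd.fibreMap {X : Scheme.{0}} {E L : X.Modules} (phi : TwistedEnd E L) (x : X) :
    Fibre E x →ₗ[Kappa x] Fibre E x ⊗[Kappa x] Fibre L x :=
  (AlgebraTensorModule.distribBaseChange (X.presheaf.stalk x) (Kappa x)
      (Stalk E x) (Stalk L x)).toLinearMap ∘ₗ (phi.map x).baseChange (Kappa x)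

/-- The `n`-fold iterate `E → E ⊗ L^{⊗ n}`, on stalks: `phi^{n+1} = (phi^n ⊗ id_L) ∘ phi`. -/
def TwistedEnd.iterate {X : Scheme.{0}} {E L : X.Modules} (phi : TwistedEnd E L) (x : X) :
    ∀ n : ℕ, Stalk E x →ₗ[X.presheaf.stalk x]
      Stalk E x ⊗[X.presheaf.stalk x] (⨂[X.presheaf.stalk x]^n (Stalk L x))
  | 0 => (LinearMap.lTensor (Stalk E x)
        (TensorPower.algebraMap₀ (R := X.presheaf.stalk x) (M := Stalk L x)).toLinearMap) ∘ₗ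
      (TensorProduct.rid (X.presheaf.stalk x) (Stalk E x)).symm.toLinearMap
  | n + 1 =>
      (LinearMap.lTensor (Stalk E x)
        ((TensorPower.mulEquiv (R := X.presheaf.stalk x) (M := Stalk L x)
            (n := n) (m := 1)).toLinearMap ∘ₗ
          LinearMap.lTensor (⨂[X.presheaf.stalk x]^n (Stalk L x))
            (PiTensorProduct.subsingletonEquiv (R := X.presheaf.stalk x)
              (s := fun _ : Fin 1 => Stalk L x) (0 : Fin 1)).symm.toLinearMap)) ∘ₗ
      (TensorProduct.assoc (X.presheaf.stalk x) (Stalk E x)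
        (⨂[X.presheaf.stalk x]^n (Stalk L x)) (Stalk L x)).toLinearMap ∘ₗ
      LinearMap.rTensor (Stalk L x) (phi.iterate x n) ∘ₗ
      phi.map x

/-- `phi` is nilpotent if some iterate `E → E ⊗ L^{⊗ n}` vanishes. -/
def TwistedEnd.IsNilpotent {X : Scheme.{0}} {E L : X.Modules} (phi : TwistedEnd E L) : Prop :=
  ∃ n : ℕ, ∀ x : X, phi.iterate x n = 0

/-- `F` is `phi`-invariant: `phi(F) ⊆ F ⊗ L`. -/
def Subbundle.IsInvariant {X : Scheme.{0}} {r : ℕ} {E : VectorBundle X r} {L : X.Modules}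
    (F : Subbundle E) (phi : TwistedEnd E.sheaf L) : Prop :=
  ∀ (x : X), ∀ s ∈ F.stalk x, phi.map x s ∈
    LinearMap.range (TensorProduct.map (F.stalk x).subtype
      (LinearMap.id : Stalk L x →ₗ[X.presheaf.stalk x] Stalk L x))

/-! ### Weight filtrations and the function `mu` -/

section Filtration

variable {K : Type} [CommRing K]

/-- The weights `γ_0 < ⋯ < γ_m` of a weighted flag `0 ⊂ W_0 ⊂ ⋯ ⊂ W_{m-1} ⊂ W_m = V` with weights
`α_0, …, α_{m-1}`: `γ_i = ∑_j α_j dim W_j - ∑_{j ≥ i} α_j dim V`. -/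
def flagWeight {V : Type} [AddCommGroup V] [Module K V] {m : ℕ} (W : Fin m → Submodule K V)
    (α : Fin m → ℚ) (i : Fin (m + 1)) : ℝ :=
  (∑ j, (α j : ℝ) * (finrank K (W j) : ℝ)) -
    ∑ j with i ≤ Fin.castSucc j, (α j : ℝ) * (finrank K V : ℝ)

/-- The ascending filtration defined by a weighted flag: `F_c` is the sum of all weight spaces of
weight at most `c`, for a one-parameter subgroup with weights `γ_i` whose flag is `W`.  It is the
largest member `W_i` of the flag (including `W_m = V`) with `γ_i ≤ c`. -/
def flagFiltration {V : Type} [AddCommGroup V] [Module K V] {m : ℕ} (W : Fin m → Submodule K V)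
    (α : Fin m → ℚ) (c : ℝ) : Submodule K V :=
  ⨆ (i : Fin (m + 1)) (_ : flagWeight W α i ≤ c),
    Fin.snoc (α := fun _ => Submodule K V) W ⊤ i

/-- The induced filtration on the dual space (the weights change sign). -/
def dualFiltration {V : Type} [AddCommGroup V] [Module K V] (F : ℝ → Submodule K V) (c : ℝ) :
    Submodule K (Dual K V) :=
  ⨅ (a : ℝ) (_ : a < -c), (F a).dualAnnihilator

/-- The induced filtration on a tensor product (the weights add up). -/
def tensorFiltration {V W : Type} [AddCommGroup V] [Module K V] [AddCommGroup W] [Module K W]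
    (F : ℝ → Submodule K V) (G : ℝ → Submodule K W) (c : ℝ) : Submodule K (V ⊗[K] W) :=
  Submodule.span K {t | ∃ (a b : ℝ) (v : V) (w : W),
    a + b ≤ c ∧ v ∈ F a ∧ w ∈ G b ∧ t = v ⊗ₜ[K] w}

/-- The induced filtration on a finite tensor product. -/
def piTensorFiltration {ι : Type} [Fintype ι] {V : ι → Type} [∀ i, AddCommGroup (V i)]
    [∀ i, Module K (V i)] (F : ∀ i, ℝ → Submodule K (V i)) (c : ℝ) :
    Submodule K (⨂[K] i, V i) :=
  Submodule.span K {t | ∃ (a : ι → ℝ) (v : ∀ i, V i),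
    ∑ i, a i ≤ c ∧ (∀ i, v i ∈ F i (a i)) ∧ t = PiTensorProduct.tprod K v}

/-- The induced filtration on an exterior power. -/
def exteriorFiltration {V : Type} [AddCommGroup V] [Module K V] (n : ℕ) (F : ℝ → Submodule K V)
    (c : ℝ) : Submodule K (⋀[K]^n V) :=
  Submodule.span K {t | ∃ (a : Fin n → ℝ) (v : Fin n → V),
    ∑ i, a i ≤ c ∧ (∀ i, v i ∈ F (a i)) ∧ t = exteriorPower.ιMulti K n v}

/-- The induced filtration on a direct sum. -/
def prodFiltration {V W : Type} [AddCommGroup V] [Module K V] [AddCommGroup W] [Module K W]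
    (F : ℝ → Submodule K V) (G : ℝ → Submodule K W) (c : ℝ) : Submodule K (V × W) :=
  (F c).prod (G c)

open Classical in
/-- The filtration of the trivial one-dimensional representation (weight zero). -/
def trivialFiltration (K : Type) [CommRing K] (c : ℝ) : Submodule K K :=
  if 0 ≤ c then ⊤ else ⊥

/-- `μ(F, [f]) = - min {c | f|_{F_c} ≠ 0}` for a nonzero functional `f` (with values in a
one-dimensional space), viewed as a point of the projective space of hyperplanes in `V`. -/
def mu {V N : Type} [AddCommGroup V] [Module K V] [AddCommGroup N] [Module K N]
    (F : ℝ → Submodule K V) (f : V →ₗ[K] N) : ℝ :=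
  - sInf {c : ℝ | ∃ v ∈ F c, f v ≠ 0}

end Filtration

/-! ### Weighted flags of a vector bundle -/

/-- A (nonempty) weighted flag `0 ⊊ E_1 ⊊ ⋯ ⊊ E_m ⊊ E` of subbundles with positive rational
weights. -/
structure WeightedFlag {X : Scheme.{0}} {r : ℕ} (E : VectorBundle X r) where
  length : ℕ
  length_pos : 0 < length
  sub : Fin length → Subbundle E
  rank_pos : ∀ i, 0 < (sub i).rank
  rank_lt : ∀ i, (sub i).rank < r
  rank_strictMono : StrictMono fun i => (sub i).rank
  stalk_mono : ∀ x : X, Monotone fun i => (sub i).stalk x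
  weight : Fin length → ℚ
  weight_pos : ∀ i, 0 < weight i

/-- `M(E_•, α) = ∑_j α_j (deg E rk E_j - deg E_j rk E)`. -/
def WeightedFlag.degreeTerm {X : Scheme.{0}} [IsIntegral X] [IsLocallyNoetherian X] {r : ℕ}
    {E : VectorBundle X r} (A : WeightedFlag E) : ℚ :=
  ∑ j, A.weight j * (((Subbundle.whole E).degree : ℚ) * ((A.sub j).rank : ℚ) -
    ((A.sub j).degree : ℚ) * (r : ℚ))

/-! ### Parabolic types and decorated swamps -/

/-- The numerical data of a parabolic structure in rank `r`: a flag type `0 < r_1 < ⋯ < r_k < r`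
and positive rational weights `β_1, …, β_k` with sum less than one. -/
structure ParabolicType (r : ℕ) where
  k : ℕ
  dim : Fin k → ℕ
  dim_strictMono : StrictMono dim
  dim_pos : ∀ i, 0 < dim i
  dim_lt : ∀ i, dim i < r
  weight : Fin k → ℚ
  weight_pos : ∀ i, 0 < weight i
  weight_sum_lt : ∑ i, weight i < 1

/-- `z`, the least common denominator of the weights. -/
def ParabolicType.z {r : ℕ} (P : ParabolicType r) : ℕ :=
  Finset.univ.lcm fun i => (P.weight i).den

/-- The natural number `z β_i`. -/
def ParabolicType.mult {r : ℕ} (P : ParabolicType r) (i : Fin P.k) : ℕ :=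
  ⌊(P.z : ℚ) * P.weight i⌋₊

/-- The index set of the tensor factors of `⨂_i (⋀^{r_i} W)^{⊗ z β_i}`. -/
abbrev ParabolicType.Index {r : ℕ} (P : ParabolicType r) : Type :=
  Σ i : Fin P.k, Fin (P.mult i)

/-- `⨂_i (⋀^{r_i} W)^{⊗ z β_i}`; its dual is the representation space `V_2 = W_σ`. -/
abbrev ParabolicType.PluckerSpace {r : ℕ} (P : ParabolicType r) (κ W : Type) [CommRing κ]
    [AddCommGroup W] [Module κ W] : Type :=
  ⨂[κ] j : P.Index, ⋀[κ]^(P.dim j.1) W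

/-- A decorated swamp for the representations `ρ = End(ℂ^r)^∨ ⊕ ℂ` and
`σ = (⨂_i (⋀^{r_i} ℂ^r)^{⊗ z β_i})^∨`: a vector bundle `E` of rank `r`, a line bundle `N`, a
nontrivial homomorphism `E_ρ = (E^∨ ⊗ E) ⊕ O_X → N` (where `E^∨ ⊗ E ≅ End(E)^∨`), and a
functional `s` on `E_σ|_{x₀}`.  The homomorphism is given by its maps of stalks; being a
homomorphism of sheaves means that it takes the local generators `e_i^∨ ⊗ e_j` of `E^∨ ⊗ E`
belonging to a local frame, and the generator `1` of `O_X`, to germs of sections of `N`. -/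
structure DecoratedSwamp (C : Curve) (x₀ : C.X) {r : ℕ} (P : ParabolicType r) where
  E : VectorBundle C.X r
  N : VectorBundle C.X 1
  phi : ∀ x : C.X,
    ((Dual (C.X.presheaf.stalk x) (Stalk E.sheaf x) ⊗[C.X.presheaf.stalk x] Stalk E.sheaf x) ×
      C.X.presheaf.stalk x) →ₗ[C.X.presheaf.stalk x] Stalk N.sheaf x
  phi_section : ∀ (U : C.X.Opens) (e : Fin r → Γ(E.sheaf, U)) (he : IsFrame E.sheaf e)
    (i j : Fin r) (x : C.X) (_ : x ∈ U),
    ∃ (V : C.X.Opens) (_ : x ∈ V) (hVU : V ≤ U) (c : Γ(N.sheaf, V)), ∀ (y : C.X) (hy : y ∈ V),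
      phi y ((he.basis y (hVU hy)).coord i ⊗ₜ germ E.sheaf y (hVU hy) (e j), 0) =
        germ N.sheaf y hy c
  phi_one_section : ∀ x : C.X, ∃ (V : C.X.Opens) (_ : x ∈ V) (c : Γ(N.sheaf, V)),
    ∀ (y : C.X) (hy : y ∈ V), phi y (0, 1) = germ N.sheaf y hy c
  phi_nontrivial : ∃ x, phi x ≠ 0
  s : Dual (Kappa x₀) (P.PluckerSpace (Kappa x₀) (Fibre E.sheaf x₀)) →ₗ[Kappa x₀] Kappa x₀

/-- `μ_1(E_•, α, φ)`, computed at the generic point. -/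
def DecoratedSwamp.mu1 {C : Curve} {x₀ : C.X} {r : ℕ} {P : ParabolicType r}
    (S : DecoratedSwamp C x₀ P) (A : WeightedFlag S.E) : ℝ :=
  let F := flagFiltration (fun j => (A.sub j).stalk (genericPoint C.X)) A.weight
  mu (V := (Dual (C.X.presheaf.stalk (genericPoint C.X)) (Stalk S.E.sheaf (genericPoint C.X))
        ⊗[C.X.presheaf.stalk (genericPoint C.X)] Stalk S.E.sheaf (genericPoint C.X)) ×
      C.X.presheaf.stalk (genericPoint C.X))
    (prodFiltration (tensorFiltration (dualFiltration F) F) (trivialFiltration _))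
    (S.phi (genericPoint C.X))

/-- `μ_2(E_•, α, s)`, computed in the fibre over `x₀`. -/
def DecoratedSwamp.mu2 {C : Curve} {x₀ : C.X} {r : ℕ} {P : ParabolicType r}
    (S : DecoratedSwamp C x₀ P) (A : WeightedFlag S.E) : ℝ :=
  let F := flagFiltration (fun j => (A.sub j).fibre x₀) A.weight
  mu (dualFiltration (piTensorFiltration fun j : P.Index => exteriorFiltration (P.dim j.1) F)) S.s

/-- Asymptotic `δ₂`-semistability. -/
def DecoratedSwamp.AsymptoticallySemistable {C : Curve} {x₀ : C.X} {r : ℕ} {P : ParabolicType r}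
    (S : DecoratedSwamp C x₀ P) (δ₂ : ℚ) : Prop :=
  ∀ A : WeightedFlag S.E, ∃ c₁ : ℚ, 0 < c₁ ∧ ∀ δ₁ : ℚ, c₁ ≤ δ₁ →
    0 ≤ (A.degreeTerm : ℝ) + (δ₁ : ℝ) * S.mu1 A + (δ₂ : ℝ) * S.mu2 A

/-- Asymptotic `δ₂`-stability. -/
def DecoratedSwamp.AsymptoticallyStable {C : Curve} {x₀ : C.X} {r : ℕ} {P : ParabolicType r}
    (S : DecoratedSwamp C x₀ P) (δ₂ : ℚ) : Prop :=
  ∀ A : WeightedFlag S.E, ∃ c₁ : ℚ, 0 < c₁ ∧ ∀ δ₁ : ℚ, c₁ ≤ δ₁ →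
    0 < (A.degreeTerm : ℝ) + (δ₁ : ℝ) * S.mu1 A + (δ₂ : ℝ) * S.mu2 A

/-! ### Parabolic Hitchin pairs -/

/-- A parabolic Hitchin pair `(E, φ, ε, V_•)` with twisting line bundle `L` and parabolic
structure of the given type at `x₀`. -/
structure HitchinPair (C : Curve) (x₀ : C.X) (L : VectorBundle C.X 1) {r : ℕ}
    (P : ParabolicType r) where
  E : VectorBundle C.X r
  phi : TwistedEnd E.sheaf L.sheaf
  eps : ℂ
  V : Fin P.k → Submodule (Kappa x₀) (Fibre E.sheaf x₀)
  finrank_V : ∀ i, finrank (Kappa x₀) (V i) = P.dim i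
  V_mono : Monotone V
  V_invariant : ∀ i, ∀ v ∈ V i, phi.fibreMap x₀ v ∈
    LinearMap.range (TensorProduct.map (V i).subtype
      (LinearMap.id : Fibre L.sheaf x₀ →ₗ[Kappa x₀] Fibre L.sheaf x₀))
  nontrivial : (∃ x, phi.map x ≠ 0) ∨ eps ≠ 0

/-- A line bundle `N` (in the role of `O_X(l)`) with inclusions `ι₁ : L → N`, `ι₂ : O_X → N`. -/
structure TargetBundle (C : Curve) (L : VectorBundle C.X 1) where
  N : VectorBundle C.X 1
  ι₁ : L.sheaf ⟶ N.sheaf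
  ι₂ : structureModule C.X ⟶ N.sheaf
  mono_ι₁ : Mono ι₁
  mono_ι₂ : Mono ι₂

lemma exists_coord_section {X : Scheme.{0}} {M : X.Modules} {U : X.Opens} {n : ℕ}
    {e : Fin n → Γ(M, U)} (he : IsFrame M e) {V : X.Opens} (hVU : V ≤ U) (s : Γ(M, V))
    (x : X) (hx : x ∈ V) (i : Fin n) :
    ∃ (W : X.Opens) (_ : x ∈ W) (hW : W ≤ V) (f : Γ(X, W)), ∀ (y : X) (hy : y ∈ W),
      (he.basis y (hVU (hW hy))).coord i (germ M y (hW hy) s) = X.presheaf.germ W y hy f := by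
  have hb : ∀ (y : X) (hy : y ∈ U) (i : Fin n), he.basis y hy i = germ M y hy (e i) :=
    fun y hy i => Basis.mk_apply _ _ i
  choose W hW g hg using fun j : Fin n => TopCat.Presheaf.exists_germ_eq X.presheaf
    ((he.basis x (hVU hx)).repr (germ M x hx s) j)
  let W₀ : X.Opens := Finset.univ.inf W ⊓ V
  have hxW : x ∈ W₀ := by
    refine ⟨?_, hx⟩
    rw [TopologicalSpace.Opens.coe_finset_inf]
    simpa using hW
  have hle : ∀ j, W₀ ≤ W j := fun j => inf_le_left.trans (Finset.inf_le (Finset.mem_univ j))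
  have hV : W₀ ≤ V := inf_le_right
  let f : Fin n → Γ(X, W₀) := fun j => X.presheaf.map (homOfLE (hle j)).op (g j)
  let t : Γ(M, W₀) := ∑ j, f j • M.presheaf.map (homOfLE (hV.trans hVU)).op (e j)
  have ht : ∀ (y : X) (hy : y ∈ W₀), germ M y hy t =
      ∑ j, X.presheaf.germ W₀ y hy (f j) • he.basis y (hVU (hV hy)) j := by
    intro y hy
    rw [germ_sum]
    refine Finset.sum_congr rfl fun j _ => ?_
    rw [germ_smul, germ_res, hb]
  have hst : germ M x hxW (M.presheaf.map (homOfLE hV).op s) = germ M x hxW t := by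
    rw [germ_res, ht]
    conv_lhs => rw [← (he.basis x (hVU hx)).sum_repr (germ M x hx s)]
    refine Finset.sum_congr rfl fun j _ => ?_
    congr 1
    rw [← hg j]
    exact (TopCat.Presheaf.germ_res_apply X.presheaf (homOfLE (hle j)) x hxW (g j)).symm
  obtain ⟨W₁, hx₁, h₁, heq⟩ := germ_eq_nhd M x hxW _ _ hst
  refine ⟨W₁, hx₁, h₁.trans hV, X.presheaf.map (homOfLE h₁).op (f i), fun y hy => ?_⟩
  have h := heq y hy
  rw [germ_res, ht] at h
  rw [h, TopCat.Presheaf.germ_res_apply X.presheaf (homOfLE h₁) y hy (f i)]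
  simp [Finsupp.single_apply]

/-- The section of `N` corresponding to `ι₂ : O_X → N`. -/
def TargetBundle.unitSection {C : Curve} {L : VectorBundle C.X 1} (T : TargetBundle C L) :
    Γ(T.N.sheaf, ⊤) :=
  T.ι₂.app ⊤ (1 : Γ(C.X, ⊤))

lemma TargetBundle.germ_unitSection_ne_zero {C : Curve} {L : VectorBundle C.X 1}
    (T : TargetBundle C L) (x : C.X) :
    germ T.N.sheaf x (U := ⊤) trivial T.unitSection ≠ 0 := by
  have := T.mono_ι₂
  let O : C.X.Modules := structureModule C.X
  let u : Γ(O, ⊤) := (1 : Γ(C.X, ⊤))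
  have h1 : stalkMap T.ι₂ x (germ O x (U := ⊤) trivial u) =
      germ T.N.sheaf x (U := ⊤) trivial T.unitSection := stalkMap_germ T.ι₂ x _ u
  rw [← h1]
  intro h
  have h2 : germ O x (U := ⊤) trivial u = germ O x (U := ⊤) trivial 0 := by
    refine (stalkMap_injective T.ι₂ x (h.trans (map_zero _).symm)).trans ?_
    exact (map_zero (TopCat.Presheaf.germ O.presheaf ⊤ x trivial).hom).symm
  obtain ⟨W, hW, i, j, e⟩ := TopCat.Presheaf.germ_eq O.presheaf x (U := ⊤) (V := ⊤) trivial trivial u 0 h2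
  have e1 : (1 : Γ(C.X, W)) = 0 := by
    rw [← map_one (C.X.presheaf.map i.op).hom, ← map_zero (C.X.presheaf.map j.op).hom]
    exact e
  have : Nonempty W := ⟨⟨x, hW⟩⟩
  exact one_ne_zero e1

section Associated

variable {C : Curve} {x₀ : C.X} {L : VectorBundle C.X 1} {r : ℕ} {P : ParabolicType r}

/-- The homomorphism `(φ̃, ε̃) : (E^∨ ⊗ E) ⊕ O_X → N`, on stalks.  Here `φ̃` is the composition
`E^∨ ⊗ E → E^∨ ⊗ E ⊗ L → L → N` of `id ⊗ φ`, the evaluation and `ι₁`, and `ε̃ = ε ι₂`. -/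
def HitchinPair.globalDecoration (H : HitchinPair C x₀ L P) (T : TargetBundle C L) (x : C.X) :
    ((Dual (C.X.presheaf.stalk x) (Stalk H.E.sheaf x) ⊗[C.X.presheaf.stalk x]
      Stalk H.E.sheaf x) × C.X.presheaf.stalk x) →ₗ[C.X.presheaf.stalk x]
      Stalk T.N.sheaf x :=
  LinearMap.coprod
    ((TensorProduct.lid (C.X.presheaf.stalk x) (Stalk T.N.sheaf x)).toLinearMap ∘ₗ
      TensorProduct.map (contractLeft (C.X.presheaf.stalk x) (Stalk H.E.sheaf x))
        (stalkMap T.ι₁ x) ∘ₗ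
      (TensorProduct.assoc (C.X.presheaf.stalk x)
        (Dual (C.X.presheaf.stalk x) (Stalk H.E.sheaf x))
        (Stalk H.E.sheaf x) (Stalk L.sheaf x)).symm.toLinearMap ∘ₗ
      LinearMap.lTensor (Dual (C.X.presheaf.stalk x) (Stalk H.E.sheaf x)) (H.phi.map x))
    (LinearMap.toSpanSingleton (C.X.presheaf.stalk x) (Stalk T.N.sheaf x)
      (C.X.presheaf.germ ⊤ x trivial (C.const H.eps) •
        germ T.N.sheaf x (U := ⊤) trivial T.unitSection))

lemma HitchinPair.globalDecoration_one (H : HitchinPair C x₀ L P) (T : TargetBundle C L)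
    (x : C.X) : H.globalDecoration T x (0, 1) =
      C.X.presheaf.germ ⊤ x trivial (C.const H.eps) •
        germ T.N.sheaf x (U := ⊤) trivial T.unitSection := by
  simp [globalDecoration]

lemma HitchinPair.globalDecoration_tmul (H : HitchinPair C x₀ L P) (T : TargetBundle C L)
    (x : C.X) (ξ : Dual (C.X.presheaf.stalk x) (Stalk H.E.sheaf x)) (v : Stalk H.E.sheaf x) :
    H.globalDecoration T x (ξ ⊗ₜ v, 0) =
      stalkMap T.ι₁ x (TensorProduct.lid _ _ (LinearMap.rTensor _ ξ (H.phi.map x v))) := by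
  simp only [globalDecoration, LinearMap.coprod_apply, map_zero, add_zero, LinearMap.comp_apply,
    LinearMap.lTensor_tmul, LinearEquiv.coe_coe]
  generalize H.phi.map x v = t
  induction t with
  | zero => simp
  | tmul a b => simp
  | add a b ha hb => rw [TensorProduct.tmul_add, map_add, map_add, map_add, ha, hb]; simp

lemma HitchinPair.globalDecoration_section (H : HitchinPair C x₀ L P) (T : TargetBundle C L)
    (U : C.X.Opens) (e : Fin r → Γ(H.E.sheaf, U)) (he : IsFrame H.E.sheaf e)
    (i j : Fin r) (x : C.X) (hx : x ∈ U) :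
    ∃ (V : C.X.Opens) (_ : x ∈ V) (hVU : V ≤ U) (c : Γ(T.N.sheaf, V)), ∀ (y : C.X) (hy : y ∈ V),
      H.globalDecoration T y
        ((he.basis y (hVU hy)).coord i ⊗ₜ germ H.E.sheaf y (hVU hy) (e j), 0) =
        germ T.N.sheaf y hy c := by
  obtain ⟨V, hxV, hVU, n, a, b, hab⟩ := H.phi.locally_section U (e j) x hx
  choose W hW hWV f hf using fun l : Fin n => exists_coord_section he hVU (a l) x hxV i
  let W₀ : C.X.Opens := Finset.univ.inf W ⊓ V
  have hxW : x ∈ W₀ := by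
    refine ⟨?_, hxV⟩
    rw [TopologicalSpace.Opens.coe_finset_inf]
    simpa using hW
  have hle : ∀ l, W₀ ≤ W l := fun l => inf_le_left.trans (Finset.inf_le (Finset.mem_univ l))
  have hV : W₀ ≤ V := inf_le_right
  refine ⟨W₀, hxW, hV.trans hVU, ∑ l, (C.X.presheaf.map (homOfLE (hle l)).op (f l)) •
    T.N.sheaf.presheaf.map (homOfLE hV).op (T.ι₁.app V (b l)), fun y hy => ?_⟩
  rw [globalDecoration_tmul, hab y (hV hy), germ_sum, map_sum, map_sum, map_sum]
  refine Finset.sum_congr rfl fun l _ => ?_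
  rw [germ_smul, germ_res, LinearMap.rTensor_tmul, hf l y (hle l hy), TensorProduct.lid_tmul,
    map_smul, stalkMap_germ,
    TopCat.Presheaf.germ_res_apply C.X.presheaf (homOfLE (hle l)) y hy (f l)]

lemma HitchinPair.globalDecoration_nontrivial (H : HitchinPair C x₀ L P) (T : TargetBundle C L) :
    ∃ x, H.globalDecoration T x ≠ 0 := by
  rcases H.nontrivial with ⟨x, hx⟩ | h
  · refine ⟨x, fun h0 => hx (LinearMap.ext fun v => ?_)⟩
    obtain ⟨U, hU, e, he⟩ := H.E.exists_frame x
    have := T.mono_ι₁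
    refine (TensorProduct.equivFinsuppOfBasisLeft (N := Stalk L.sheaf x)
      (he.basis x hU)).injective ?_
    rw [LinearMap.zero_apply, map_zero]
    ext i
    have h1 := H.globalDecoration_tmul T x ((he.basis x hU).coord i) v
    rw [h0, LinearMap.zero_apply] at h1
    have h2 := stalkMap_injective T.ι₁ x (h1.symm.trans (map_zero _).symm)
    rw [TensorProduct.equivFinsuppOfBasisLeft_apply]
    exact h2
  · refine ⟨genericPoint C.X, fun h0 => ?_⟩
    have h1 := H.globalDecoration_one T (genericPoint C.X)
    rw [h0, LinearMap.zero_apply] at h1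
    have hu : IsUnit (C.X.presheaf.germ ⊤ (genericPoint C.X) trivial (C.const H.eps)) :=
      ((IsUnit.mk0 _ h).map C.const).map (C.X.presheaf.germ ⊤ (genericPoint C.X) trivial).hom
    exact T.germ_unitSection_ne_zero _ (hu.smul_eq_zero.1 h1.symm)

/-- A chosen basis of the subspace `V_i` of the fibre over `x₀`. -/
def HitchinPair.flagBasis (H : HitchinPair C x₀ L P) (i : Fin P.k) :
    Basis (Fin (P.dim i)) (Kappa x₀) (H.V i) :=
  have : Module.Free (Kappa x₀) (H.V i) := Module.Free.of_divisionRing (Kappa x₀) (H.V i)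
  have : Module.Finite (Kappa x₀) (H.V i) :=
    Module.finite_of_finrank_pos (by rw [H.finrank_V]; exact P.dim_pos i)
  Module.finBasisOfFinrankEq _ _ (H.finrank_V i)

/-- A vector spanning the line `⨂_i (⋀^{r_i} V_i)^{⊗ z β_i}`, which is the point defined by the
flag `V_•` under the Plücker and Segre embeddings. -/
def HitchinPair.pluckerVector (H : HitchinPair C x₀ L P) :
    P.PluckerSpace (Kappa x₀) (Fibre H.E.sheaf x₀) :=
  PiTensorProduct.tprod (Kappa x₀) fun j : P.Index =>
    exteriorPower.ιMulti (Kappa x₀) (P.dim j.1) fun l => (H.flagBasis j.1 l : Fibre H.E.sheaf x₀)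

/-- The decorated swamp associated with a parabolic Hitchin pair. -/
def HitchinPair.associatedSwamp (H : HitchinPair C x₀ L P) (T : TargetBundle C L) :
    DecoratedSwamp C x₀ P where
  E := H.E
  N := T.N
  phi := H.globalDecoration T
  phi_section := H.globalDecoration_section T
  phi_one_section x := ⟨⊤, trivial, C.const H.eps • T.unitSection, fun y hy => by
    rw [H.globalDecoration_one, germ_smul]⟩
  phi_nontrivial := H.globalDecoration_nontrivial T
  s := Dual.eval _ _ H.pluckerVector

/-- A parabolic Hitchin pair is semistable if its associated decorated swamp is asymptotically
`1/z`-semistable. -/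
def HitchinPair.IsSemistable (H : HitchinPair C x₀ L P) (T : TargetBundle C L) : Prop :=
  (H.associatedSwamp T).AsymptoticallySemistable (1 / (P.z : ℚ))

/-- A parabolic Hitchin pair is stable if its associated decorated swamp is asymptotically
`1/z`-stable. -/
def HitchinPair.IsStable (H : HitchinPair C x₀ L P) (T : TargetBundle C L) : Prop :=
  (H.associatedSwamp T).AsymptoticallyStable (1 / (P.z : ℚ))

/-- `pardeg_β(F) = deg F + ∑_i β_i dim (F|_{x₀} ∩ V_i)`. -/
def HitchinPair.pardeg (H : HitchinPair C x₀ L P) (F : Subbundle H.E) : ℚ :=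
  (F.degree : ℚ) +
    ∑ i, P.weight i * (finrank (Kappa x₀) (F.fibre x₀ ⊓ H.V i : Submodule _ _) : ℚ)

end Associated

end

end ParHitchin

/-! For a fixed weighted flag the stability expression is affine in `δ₁`. Its sign for large `δ₁` is
therefore lexicographic (`asymptotically_nonneg_iff`, `asymptotically_pos_iff`): either `μ₁ > 0`, or
`μ₁ = 0` and `M + δ₂ μ₂` has the required sign.

The second quantity splits along the flag. A basis of `V_i` adapted to the flag computes the weight
of its Plücker vector from the dimensions of `V_i ∩ E_j|_{x₀}` (`hasWeight_ιMulti_basis`). Since `δ₂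
· zβ_i = β_i`, `HitchinPair.degreeTerm_add_mu2` gives `M + δ₂ μ₂ = ∑ α_j (pardeg E · rk E_j - pardeg
E_j · r)`, a positive combination of the slope differences of the members.

For `μ₁`, a generator of `L` at the generic point turns `φ` into an endomorphism `ψ` of the generic
stalk. By `exists_endFiltration_iff` the decoration sees the block of `ψ` from step `i` to step `k`
in weight `γ_i - γ_k`, and the constant `ε` in weight `0`. Hence `μ₁ ≤ 0` exactly when all members
are `ψ`-invariant, and `μ₁ < 0` forces `ε = 0` and `ψ` to move each step into the preceding one, so
that `ψ` is nilpotent. Conversely, if `ε = 0` and `ψ` is nilpotent, the pair being nontrivial gives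
`ψ ≠ 0`, and the flag of kernels of powers of `ψ` has `μ₁ < 0` (`HitchinPair.exists_mu1_neg`).

Two facts link the generic point to the curve. Subspaces of the generic stalk extend to subbundles
(`saturation`), because the local rings are principal ideal rings and Smith normal form applies.
Invariance and nilpotency can be tested generically (`Subbundle.isInvariant_iff`,
`TwistedEnd.isNilpotent_iff`). `HitchinPair.forall_flag_iff` assembles the equivalence, with
one-step flags recovering each invariant subbundle. -/

namespace ParHitchin

noncomputable section

/-! ### Stalks of a smooth curve -/

/-- The conormal map `m/m² → κ ⊗ Ω_R` is split injective because `κ` is formally smooth over `k`,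
and `Ω_R` is free of rank one. Stating a bound rather than an equality covers the generic point
along with the closed ones. -/
lemma finrank_cotangentSpace_le_one_of_smooth {k B R : Type} [Field k] [CharZero k] [CommRing B]
    [Algebra k B] [Algebra.IsStandardSmoothOfRelativeDimension 1 k B] [CommRing R] [IsLocalRing R]
    [Algebra B R] (p : Ideal B) [p.IsPrime] [IsLocalization.AtPrime R p] :
    finrank (IsLocalRing.ResidueField R) (IsLocalRing.CotangentSpace R) ≤ 1 := by
  let _ : Algebra k R := ((algebraMap B R).comp (algebraMap k B)).toAlgebra
  have : IsScalarTower k B R := .of_algebraMap_eq fun _ => rfl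
  have : Nontrivial B := (algebraMap B R).domain_nontrivial
  have hB : Algebra.IsStandardSmooth k B :=
    Algebra.IsStandardSmoothOfRelativeDimension.isStandardSmooth (n := 1)
  have : Algebra.FormallySmooth k B := inferInstance
  have : Algebra.FormallyEtale B R := .of_isLocalization p.primeCompl
  have : Algebra.FormallySmooth k R := .comp k B R
  have : Algebra.EssFiniteType B R := .of_isLocalization R p.primeCompl
  have : Algebra.EssFiniteType k R := .comp k B R
  let κ := IsLocalRing.ResidueField R
  have : Algebra.EssFiniteType R κ := inferInstance
  have : Algebra.EssFiniteType k κ := .comp k R κ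
  -- Characteristic zero enters here: the residue field extension is separable.
  have : Algebra.FormallySmooth k κ := inferInstance
  have hs : Function.Surjective (algebraMap R κ) := IsLocalRing.residue_surjective
  obtain ⟨l, hl⟩ := (Algebra.FormallySmooth.iff_split_injection (R := k) (P := R) hs).1 inferInstance
  have hinj : Function.Injective (KaehlerDifferential.kerCotangentToTensor k R κ) :=
    Function.LeftInverse.injective (g := l) fun x => LinearMap.congr_fun hl x
  have hΩ : finrank B (Ω[B⁄k]) = 1 := by
    rw [finrank, Algebra.IsStandardSmoothOfRelativeDimension.rank_kaehlerDifferential 1]; simp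
  have : Module.Free B (Ω[B⁄k]) := inferInstance
  have : Module.Finite B (Ω[B⁄k]) := inferInstance
  let e := KaehlerDifferential.tensorKaehlerEquivOfFormallyEtale k B R
  have hΩR : finrank R (Ω[R⁄k]) = 1 := by
    rw [← e.finrank_eq, finrank_baseChange, hΩ]
  have : Module.Free R (Ω[R⁄k]) := .of_equiv e
  have : Module.Finite R (Ω[R⁄k]) := .equiv e
  have h1 : finrank κ (κ ⊗[R] Ω[R⁄k]) = 1 := by rw [finrank_baseChange, hΩR]
  -- The kernel equals the maximal ideal only propositionally, so the ideal is generalized before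
  -- transporting the map.
  have hex : ∀ I : Ideal R, RingHom.ker (algebraMap R κ) = I →
      ∃ f : I.Cotangent →ₗ[R] κ ⊗[R] Ω[R⁄k], Function.Injective f := by
    rintro _ rfl
    exact ⟨_, hinj⟩
  obtain ⟨f, hf⟩ := hex _ IsLocalRing.ker_residue
  let g : IsLocalRing.CotangentSpace R →ₗ[κ] κ ⊗[R] Ω[R⁄k] :=
    LinearMap.extendScalarsOfSurjective hs f
  have : Module.Finite κ (κ ⊗[R] Ω[R⁄k]) := inferInstance
  exact (LinearMap.finrank_le_finrank_of_injective (f := g) hf).trans h1.le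

/-- A noetherian local domain with cotangent space of dimension at most one is a principal ideal
ring; this is what makes Smith normal form available at every stalk. -/
lemma isPrincipalIdealRing_stalk (C : Curve) (x : C.X) :
    IsPrincipalIdealRing (C.X.presheaf.stalk x) := by
  have hC := C.smooth
  obtain ⟨U, hU, V, hV, hx, e, h⟩ := hC.exists_isStandardSmoothOfRelativeDimension x
  -- `Spec ℂ` is a single point, so the nonempty chart of the base is everything.
  have hUt : U = ⊤ := by
    have : Subsingleton (Spec (CommRingCat.of ℂ)) := inferInstance
    refine top_le_iff.1 fun y _ => ?_
    rw [Subsingleton.elim y (C.str x)]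
    exact e hx
  subst hUt
  let i : CommRingCat.of ℂ ≅ Γ(Spec (CommRingCat.of ℂ), ⊤) :=
    (Scheme.ΓSpecIso (CommRingCat.of ℂ)).symm
  have h2 := RingHom.isStandardSmoothOfRelativeDimension_respectsIso.2 (C.str.appLE ⊤ V e).hom
    i.commRingCatIsoToRingEquiv h
  let f : ℂ →+* Γ(C.X, V) := (C.str.appLE ⊤ V e).hom.comp i.commRingCatIsoToRingEquiv.toRingHom
  let _ : Algebra ℂ Γ(C.X, V) := f.toAlgebra
  have : Algebra.IsStandardSmoothOfRelativeDimension 1 ℂ Γ(C.X, V) := h2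
  let y : V := ⟨x, hx⟩
  let _ := TopCat.Presheaf.algebra_section_stalk C.X.presheaf y
  have := hV.isLocalization_stalk y
  have hle := finrank_cotangentSpace_le_one_of_smooth (k := ℂ) (B := Γ(C.X, V))
    (R := C.X.presheaf.stalk x) (hV.primeIdealOf y).asIdeal
  exact ((tfae_of_isNoetherianRing_of_isLocalRing_of_isDomain (C.X.presheaf.stalk x)).out 5 0).1 hle

/-! ### Weighted flags of a vector space -/

section Flags

variable {K : Type} [Field K] {V : Type} [AddCommGroup V] [Module K V] {m : ℕ}

/-- The members of a flag, including the whole space. -/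
def flagStep (W : Fin m → Submodule K V) : Fin (m + 1) → Submodule K V :=
  Fin.snoc (α := fun _ => Submodule K V) W ⊤

@[simp] lemma flagStep_castSucc (W : Fin m → Submodule K V) (i : Fin m) :
    flagStep W i.castSucc = W i := Fin.snoc_castSucc ..

@[simp] lemma flagStep_last (W : Fin m → Submodule K V) : flagStep W (Fin.last m) = ⊤ :=
  Fin.snoc_last ..

lemma flagStep_mono {W : Fin m → Submodule K V} (hW : Monotone W) : Monotone (flagStep W) := by
  intro i j hij
  induction j using Fin.lastCases with
  | last => simp
  | cast j =>
    induction i using Fin.lastCases with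
    | last => exact absurd hij (not_le.2 (Fin.castSucc_lt_last j))
    | cast i => simpa using hW (Fin.castSucc_le_castSucc_iff.1 hij)

/-- Passing from `i` to a larger index removes positive terms from the subtracted sum, among them
the one with `j = i`. -/
lemma flagWeight_strictMono [FiniteDimensional K V] [Nontrivial V] (W : Fin m → Submodule K V)
    {α : Fin m → ℚ} (hα : ∀ i, 0 < α i) : StrictMono (flagWeight W α) := by
  intro i k hik
  refine sub_lt_sub_left ?_ _
  have hV : (0 : ℝ) < finrank K V := by exact_mod_cast finrank_pos
  have hpos : ∀ j, (0 : ℝ) < (α j : ℝ) * (finrank K V : ℝ) := fun j =>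
    mul_pos (by exact_mod_cast hα j) hV
  have hi : i ≠ Fin.last m := (hik.trans_le (Fin.le_last k)).ne
  refine Finset.sum_lt_sum_of_subset (i := i.castPred hi) ?_ ?_ ?_ (hpos _) ?_
  · exact Finset.monotone_filter_right _ fun j _ hj => hik.le.trans hj
  · simp
  · simpa using hik
  · exact fun j _ _ => (hpos j).le

lemma flagStep_le_flagFiltration (W : Fin m → Submodule K V) (α : Fin m → ℚ) {c : ℝ}
    {i : Fin (m + 1)} (h : flagWeight W α i ≤ c) : flagStep W i ≤ flagFiltration W α c :=
  le_iSup₂_of_le i h le_rfl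

lemma flagFiltration_le {W : Fin m → Submodule K V} {α : Fin m → ℚ} {c : ℝ} {U : Submodule K V}
    (h : ∀ i, flagWeight W α i ≤ c → flagStep W i ≤ U) : flagFiltration W α c ≤ U :=
  iSup₂_le h

lemma mem_dualFiltration {F : ℝ → Submodule K V} {c : ℝ} {ξ : Dual K V} :
    ξ ∈ dualFiltration F c ↔ ∀ a < -c, ∀ v ∈ F a, ξ v = 0 := by
  simp [dualFiltration, Submodule.mem_iInf, Submodule.mem_dualAnnihilator]

/-- The sum of the members of a flag before the `i`-th one. -/
def flagBefore (W : Fin m → Submodule K V) (i : Fin (m + 1)) : Submodule K V :=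
  ⨆ (l : Fin (m + 1)) (_ : l < i), flagStep W l

lemma flagStep_le_flagBefore (W : Fin m → Submodule K V) {l i : Fin (m + 1)} (h : l < i) :
    flagStep W l ≤ flagBefore W i :=
  le_iSup₂_of_le l h le_rfl

lemma flagBefore_le {W : Fin m → Submodule K V} {i : Fin (m + 1)} {U : Submodule K V}
    (h : ∀ l < i, flagStep W l ≤ U) : flagBefore W i ≤ U :=
  iSup₂_le h

/-- Each application of `ψ` descends one step, so `ψ ^ (i + 1)` kills step `i`; the last of the `m +
1` steps is all of `V`. -/
lemma pow_eq_zero_of_flagBefore {W : Fin m → Submodule K V} {ψ : V →ₗ[K] V}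
    (h : ∀ i, (flagStep W i).map ψ ≤ flagBefore W i) :
    ψ ^ (m + 1) = 0 := by
  have key : ∀ i : Fin (m + 1), flagStep W i ≤ LinearMap.ker (ψ ^ (i.val + 1)) := by
    intro i
    induction i using WellFoundedLT.induction with
    | ind i ih =>
      intro v hv
      have h1 : flagBefore W i ≤ LinearMap.ker (ψ ^ i.val) := flagBefore_le fun l hl u hu => by
        have h2 := LinearMap.mem_ker.1 (ih l hl hu)
        rw [LinearMap.mem_ker, ← Nat.sub_add_cancel (Nat.succ_le_of_lt hl), pow_add,
          Module.End.mul_apply, Nat.succ_eq_add_one, h2, map_zero]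
      have h3 := h1 (h i ⟨v, hv, rfl⟩)
      rwa [LinearMap.mem_ker, pow_succ]
  refine LinearMap.ext fun v => ?_
  have := key (Fin.last m) (by simp : v ∈ _)
  simpa using this

end Flags

/-! ### The weight of an endomorphism together with a constant -/

section EndWeight

variable {K : Type} [Field K] {V : Type} [AddCommGroup V] [Module K V] {m : ℕ}
  {N : Type} [AddCommGroup N] [Module K N]

/-- The filtration of `(V^∨ ⊗ V) ⊕ K` induced by a weighted flag of `V`. -/
abbrev endFiltration (W : Fin m → Submodule K V) (α : Fin m → ℚ) :
    ℝ → Submodule K ((Dual K V ⊗[K] V) × K) :=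
  prodFiltration (tensorFiltration (dualFiltration (flagFiltration W α)) (flagFiltration W α))
    (trivialFiltration K)

/-- The value of `μ` for a functional on `(V^∨ ⊗ V) ⊕ K` and a weighted flag of `V`. -/
abbrev endMu (W : Fin m → Submodule K V) (α : Fin m → ℚ)
    (Φ : ((Dual K V ⊗[K] V) × K) →ₗ[K] N) : ℝ :=
  mu (V := (Dual K V ⊗[K] V) × K) (endFiltration W α) Φ

/-- The functional `ξ ⊗ v ↦ ξ(ψ v) n₁`, `1 ↦ n₂` on `(V^∨ ⊗ V) ⊕ K`. -/
structure IsEndFunctional (ψ : V →ₗ[K] V) (n₁ n₂ : N)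
    (Φ : ((Dual K V ⊗[K] V) × K) →ₗ[K] N) : Prop where
  apply_tmul : ∀ (ξ : Dual K V) (v : V), Φ (ξ ⊗ₜ v, 0) = ξ (ψ v) • n₁
  apply_one : Φ (0, 1) = n₂
  ne_zero : n₁ ≠ 0

variable [FiniteDimensional K V] [Nontrivial V] {W : Fin m → Submodule K V}
  {α : Fin m → ℚ} {ψ : V →ₗ[K] V} {n₁ n₂ : N} {Φ : ((Dual K V ⊗[K] V) × K) →ₗ[K] N}

/-- In block form: a functional of weight `-γ_k` is one that kills everything before step `k`, so
pairing it with `ψ v` for `v` in step `i` detects whether `ψ` maps step `i` outside `flagBefore W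
k`. The summand `K` contributes in weight zero. -/
lemma exists_endFiltration_iff (hα : ∀ i, 0 < α i) (hΦ : IsEndFunctional ψ n₁ n₂ Φ) (c : ℝ) :
    (∃ t ∈ endFiltration W α c, Φ t ≠ 0) ↔
      (∃ i k, flagWeight W α i - flagWeight W α k ≤ c ∧
        ¬ (flagStep W i).map ψ ≤ flagBefore W k) ∨ (0 ≤ c ∧ n₂ ≠ 0) := by
  have hmono := flagWeight_strictMono W hα
  constructor
  · rintro ⟨⟨t, a⟩, ⟨ht, ha⟩, hne⟩
    by_contra! hcon
    obtain ⟨h1, h2⟩ := hcon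
    apply hne
    have hsplit : ((t, a) : (Dual K V ⊗[K] V) × K) = (t, 0) + a • (0, 1) := by simp
    have hA : Φ (t, 0) = 0 := by
      replace ht : t ∈ tensorFiltration _ _ c := ht
      clear hne ha hsplit
      induction ht using Submodule.span_induction with
      | zero => exact map_zero Φ
      | add x y _ _ hx hy =>
        have : ((x + y, 0) : (Dual K V ⊗[K] V) × K) = (x, 0) + (y, 0) := by simp
        rw [this, map_add, hx, hy, add_zero]
      | smul b x _ hx =>
        have : ((b • x, 0) : (Dual K V ⊗[K] V) × K) = b • (x, 0) := by simp
        rw [this, map_smul, hx, smul_zero]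
      | mem x hx =>
        obtain ⟨p, q, ξ, v, hpq, hξ, hv, rfl⟩ := hx
        rw [hΦ.apply_tmul]
        suffices ξ (ψ v) = 0 by rw [this, zero_smul]
        by_contra hne'
        -- The filtration step is a supremum of flag members, so nonvanishing is already visible on
        -- one of them.
        have hi : ∃ i, flagWeight W α i ≤ q ∧ ∃ w ∈ flagStep W i, ξ (ψ w) ≠ 0 := by
          by_contra! hno
          exact hne' (flagFiltration_le (U := LinearMap.ker (ξ ∘ₗ ψ))
            (fun i hi w hw => hno i hi w hw) hv)
        obtain ⟨i, hiq, w, hw, hξw⟩ := hi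
        -- Take the first step `k` not killed by `ξ`: its weight is at least `-p`, while `ξ` kills
        -- `flagBefore W k`, so the block `(i, k)` contradicts the vanishing assumed in `h1`.
        have hex : ∃ k, ¬ flagStep W k ≤ LinearMap.ker ξ :=
          ⟨Fin.last m, fun h => hξw (h (by simp : ψ w ∈ _))⟩
        obtain ⟨k, hk, hmin⟩ := WellFounded.has_min (wellFounded_lt (α := Fin (m + 1)))
          {k | ¬ flagStep W k ≤ LinearMap.ker ξ} hex
        have hkp : -p ≤ flagWeight W α k := by
          by_contra! hlt
          exact hk fun u hu => mem_dualFiltration.1 hξ _ hlt u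
            (flagStep_le_flagFiltration W α le_rfl hu)
        have hbefore : flagBefore W k ≤ LinearMap.ker ξ := flagBefore_le fun l hl => by
          by_contra hl'
          exact hmin l hl' hl
        exact hξw (hbefore (h1 i k (by linarith) ⟨w, hw, rfl⟩))
    rw [hsplit, map_add, hA, map_smul, hΦ.apply_one, zero_add]
    by_cases hc : 0 ≤ c
    · rw [h2 hc, smul_zero]
    · have : a ∈ trivialFiltration K c := ha
      rw [trivialFiltration, if_neg hc] at this
      rw [(Submodule.mem_bot K).1 this, zero_smul]
  · rintro (⟨i, k, hik, hn⟩ | ⟨hc, hn⟩)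
    · obtain ⟨_, ⟨v, hv, rfl⟩, hvn⟩ := Set.not_subset.1 hn
      -- A functional separating `ψ v` from `flagBefore W k` has weight `-γ_k`: by strict
      -- monotonicity the steps of weight below `γ_k` all precede `k`.
      obtain ⟨ξ, hξ, hξ'⟩ := Submodule.exists_dual_map_eq_bot_of_notMem (p := flagBefore W k)
        (x := ψ v) hvn inferInstance
      have hker : flagBefore W k ≤ LinearMap.ker ξ := LinearMap.le_ker_iff_map.2 hξ'
      refine ⟨(ξ ⊗ₜ v, 0), ⟨Submodule.subset_span ⟨-flagWeight W α k, flagWeight W α i, ξ, v,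
        by linarith, ?_, flagStep_le_flagFiltration W α le_rfl hv, rfl⟩, zero_mem _⟩, ?_⟩
      · refine mem_dualFiltration.2 fun a ha u hu => ?_
        rw [neg_neg] at ha
        exact flagFiltration_le (U := LinearMap.ker ξ) (fun l hl =>
          (flagStep_le_flagBefore W (hmono.lt_iff_lt.1 (hl.trans_lt ha))).trans hker) hu
      · rw [hΦ.apply_tmul]
        exact smul_ne_zero hξ hΦ.ne_zero
    · refine ⟨(0, 1), ⟨zero_mem _, ?_⟩, by rwa [hΦ.apply_one]⟩
      change (1 : K) ∈ trivialFiltration K c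
      rw [trivialFiltration, if_pos hc]
      trivial

/-- Invariance makes `ψ` block triangular, so only blocks with `k ≤ i` survive, and these have
nonnegative weight. -/
lemma mu_endFiltration_nonpos (hα : ∀ i, 0 < α i)
    (hΦ : IsEndFunctional ψ n₁ n₂ Φ) (hψ : ∀ j, ∀ v ∈ W j, ψ v ∈ W j) :
    endMu W α Φ ≤ 0 := by
  refine neg_nonpos.2 (Real.sInf_nonneg fun c hc => ?_)
  rcases (exists_endFiltration_iff hα hΦ c).1 hc with ⟨i, k, hik, hn⟩ | ⟨h, -⟩
  · have hki : k ≤ i := by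
      by_contra! hlt
      refine hn (le_trans ?_ (flagStep_le_flagBefore W hlt))
      rintro _ ⟨v, hv, rfl⟩
      induction i using Fin.lastCases with
      | last => simp
      | cast j => simpa using hψ j v (by simpa using hv)
    have := (flagWeight_strictMono W hα).monotone hki
    linarith
  · exact h

lemma bddBelow_endFiltration (hα : ∀ i, 0 < α i) (hΦ : IsEndFunctional ψ n₁ n₂ Φ) :
    BddBelow {c : ℝ | ∃ t ∈ endFiltration W α c, Φ t ≠ 0} := by
  have hmono := (flagWeight_strictMono W hα).monotone
  refine ⟨flagWeight W α 0 - flagWeight W α (Fin.last m), fun c hc => ?_⟩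
  rcases (exists_endFiltration_iff hα hΦ c).1 hc with ⟨i, k, hik, -⟩ | ⟨h, -⟩
  · have := hmono (Fin.zero_le i)
    have := hmono (Fin.le_last k)
    linarith
  · have := hmono (Fin.zero_le (Fin.last m))
    linarith

/-- A vector of `W j` leaving `W j` produces a nonzero block from step `j` to step `j + 1`, whose
weight is negative and would make `μ` positive. -/
lemma invariant_of_mu_endFiltration_nonpos (hW : Monotone W) (hα : ∀ i, 0 < α i)
    (hΦ : IsEndFunctional ψ n₁ n₂ Φ) (hmu : endMu W α Φ ≤ 0) (j : Fin m) (v : V)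
    (hv : v ∈ W j) : ψ v ∈ W j := by
  by_contra hn
  have hmem : flagWeight W α j.castSucc - flagWeight W α j.succ ∈
      {c : ℝ | ∃ t ∈ endFiltration W α c, Φ t ≠ 0} := by
    refine (exists_endFiltration_iff hα hΦ _).2 (Or.inl ⟨_, _, le_rfl, fun h => hn ?_⟩)
    have h1 : flagBefore W j.succ ≤ W j := flagBefore_le fun l hl => by
      rw [← flagStep_castSucc W j]
      exact flagStep_mono hW (Fin.le_castSucc_iff.2 hl)
    exact h1 (h ⟨v, by simpa using hv, rfl⟩)
  have h1 := csInf_le (bddBelow_endFiltration hα hΦ) hmem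
  have h2 := flagWeight_strictMono W hα (Fin.castSucc_lt_succ (i := j))
  have h3 : 0 ≤ sInf {c : ℝ | ∃ t ∈ endFiltration W α c, Φ t ≠ 0} := neg_nonpos.1 hmu
  linarith

/-- Negative `μ` means that nothing is detected in weight `0`, where both the constant and the
diagonal blocks live. -/
lemma flagBefore_of_mu_endFiltration_neg (hα : ∀ i, 0 < α i) (hΦ : IsEndFunctional ψ n₁ n₂ Φ)
    (hmu : endMu W α Φ < 0) :
    n₂ = 0 ∧ ∀ i, (flagStep W i).map ψ ≤ flagBefore W i := by
  have h0 : (0 : ℝ) ∉ {c : ℝ | ∃ t ∈ endFiltration W α c, Φ t ≠ 0} := fun h =>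
    (neg_neg_iff_pos.1 hmu).not_ge (csInf_le (bddBelow_endFiltration hα hΦ) h)
  have h1 : ¬ ((∃ i k, flagWeight W α i - flagWeight W α k ≤ 0 ∧
        ¬ (flagStep W i).map ψ ≤ flagBefore W k) ∨ ((0 : ℝ) ≤ 0 ∧ n₂ ≠ 0)) := fun h =>
    h0 ((exists_endFiltration_iff hα hΦ 0).2 h)
  push Not at h1
  exact ⟨h1.2 le_rfl, fun i => h1.1 i i (sub_self _).le⟩

/-- All nonzero blocks strictly descend. There are finitely many, so the smallest of their positive
weights bounds the infimum away from zero. -/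
lemma mu_endFiltration_neg (hα : ∀ i, 0 < α i) (hΦ : IsEndFunctional ψ n₁ 0 Φ) (hψ : ψ ≠ 0)
    (h : ∀ i, (flagStep W i).map ψ ≤ flagBefore W i) : endMu W α Φ < 0 := by
  have hmono := flagWeight_strictMono W hα
  have hmem : ∀ c : ℝ, (∃ t ∈ endFiltration W α c, Φ t ≠ 0) ↔
      ∃ i k, flagWeight W α i - flagWeight W α k ≤ c ∧
        ¬ (flagStep W i).map ψ ≤ flagBefore W k := fun c => by
    rw [exists_endFiltration_iff hα hΦ]; simp
  let T : Set (Fin (m + 1) × Fin (m + 1)) := {p | ¬ (flagStep W p.1).map ψ ≤ flagBefore W p.2}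
  -- Needed because the infimum of the empty set is `0` by convention. Nothing precedes step `0`, so
  -- the block from the last step to step `0` is nonzero as soon as `ψ ≠ 0`.
  have hT : T.Nonempty := by
    refine ⟨(Fin.last m, 0), fun hle => hψ (LinearMap.ext fun v => ?_)⟩
    have h2 : flagBefore W 0 ≤ ⊥ := flagBefore_le fun l hl => absurd hl (Fin.not_lt_zero l)
    simpa using h2 (hle ⟨v, by simp, rfl⟩)
  obtain ⟨p, hp, hmin⟩ := Set.exists_min_image T
    (fun p => flagWeight W α p.1 - flagWeight W α p.2) T.toFinite hT
  have hlt : p.2 < p.1 := by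
    by_contra! hle
    exact hp ((h p.1).trans (flagBefore_le fun l hl =>
      flagStep_le_flagBefore W (hl.trans_le hle)))
  have hpmem := (hmem _).2 ⟨_, _, le_rfl, hp⟩
  refine neg_neg_iff_pos.2 (lt_of_lt_of_le (sub_pos.2 (hmono hlt)) (le_csInf ⟨_, hpmem⟩ ?_))
  intro c hc
  obtain ⟨i, k, hik, hn⟩ := (hmem c).1 hc
  exact (hmin (i, k) hn).trans hik

end EndWeight

/-! ### Vectors of a given weight -/

section HasWeight

variable {K : Type} [Field K] {V : Type} [AddCommGroup V] [Module K V]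

/-- `x` lies in `F_w`, and this is witnessed to be optimal by a functional. -/
structure HasWeight (F : ℝ → Submodule K V) (x : V) (w : ℝ) : Prop where
  mem : x ∈ F w
  exists_dual : ∃ f : Dual K V, f x ≠ 0 ∧ ∀ a < w, ∀ y ∈ F a, f y = 0

lemma HasWeight.smul {F : ℝ → Submodule K V} {x : V} {w : ℝ} (h : HasWeight F x w) {c : K}
    (hc : c ≠ 0) : HasWeight F (c • x) w := by
  obtain ⟨f, hf, hF⟩ := h.exists_dual
  exact ⟨Submodule.smul_mem _ _ h.mem, f, by simpa using ⟨hc, hf⟩, hF⟩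

/-- Evaluation at `x` is nonzero on the dual filtration exactly from `-w` on; the sign in `mu`
cancels the sign of the dual. -/
lemma HasWeight.mu_eval {F : ℝ → Submodule K V} {x : V} {w : ℝ} (h : HasWeight F x w) :
    mu (V := Dual K V) (dualFiltration F) (Dual.eval K V x) = w := by
  have : {c : ℝ | ∃ f ∈ dualFiltration F c, Dual.eval K V x f ≠ 0} = Set.Ici (-w) := by
    ext c
    constructor
    · rintro ⟨f, hf, hx⟩
      by_contra! hc
      exact hx (mem_dualFiltration.1 hf w (lt_neg_of_lt_neg (by simpa using hc)) x h.mem)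
    · intro hc
      obtain ⟨f, hf, hF⟩ := h.exists_dual
      exact ⟨f, mem_dualFiltration.2 fun a ha => hF a (ha.trans_le (neg_le.1 hc)), hf⟩
  rw [mu, this, csInf_Ici, neg_neg]

/-- The product of the witnessing functionals is a witness: if the total weight is too small, some
factor is already too small and its functional vanishes. -/
lemma HasWeight.tprod {ι : Type} [Fintype ι] {V : ι → Type} [∀ i, AddCommGroup (V i)]
    [∀ i, Module K (V i)] {F : ∀ i, ℝ → Submodule K (V i)} {x : ∀ i, V i} {w : ι → ℝ}
    (h : ∀ i, HasWeight (F i) (x i) (w i)) :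
    HasWeight (piTensorFiltration F) (PiTensorProduct.tprod K x) (∑ i, w i) := by
  refine ⟨Submodule.subset_span ⟨w, x, le_rfl, fun i => (h i).mem, rfl⟩, ?_⟩
  choose f hf hF using fun i => (h i).exists_dual
  let g : Dual K (⨂[K] i, V i) :=
    PiTensorProduct.lift ((MultilinearMap.mkPiAlgebra K ι K).compLinearMap f)
  have hg : ∀ y : ∀ i, V i, g (PiTensorProduct.tprod K y) = ∏ i, f i (y i) := fun y => by
    simp [g]
  refine ⟨g, ?_, fun a ha y hy => ?_⟩
  · rw [hg]
    exact Finset.prod_ne_zero_iff.2 fun i _ => hf i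
  · refine (Submodule.span_le (p := LinearMap.ker g)).2 ?_ hy
    rintro _ ⟨b, v, hb, hv, rfl⟩
    obtain ⟨i, -, hi⟩ := Finset.exists_lt_of_sum_lt (hb.trans_lt ha)
    rw [SetLike.mem_coe, LinearMap.mem_ker, hg]
    exact Finset.prod_eq_zero (Finset.mem_univ i) (hF i _ hi _ (hv i))

/-- The witness is the determinant of the pairings with `ξ`. On a wedge of smaller total weight,
every term of the Leibniz expansion contains a vanishing factor. -/
lemma HasWeight.ιMulti {F : ℝ → Submodule K V} {n : ℕ} {v : Fin n → V} {a : Fin n → ℝ}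
    {ξ : Fin n → Dual K V} (hv : ∀ l, v l ∈ F (a l)) (hξ : ∀ l, ∀ b < a l, ∀ y ∈ F b, ξ l y = 0)
    (hξv : ∀ l k, ξ l (v k) = if l = k then 1 else 0) :
    HasWeight (exteriorFiltration n F) (exteriorPower.ιMulti K n v) (∑ l, a l) := by
  refine ⟨Submodule.subset_span ⟨a, v, le_rfl, hv, rfl⟩, ?_⟩
  let D : V [⋀^Fin n]→ₗ[K] K := Matrix.detRowAlternating.compLinearMap (LinearMap.pi ξ)
  have hD : ∀ y : Fin n → V, D y = Matrix.det (Matrix.of fun k l => ξ l (y k)) := fun y => rfl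
  let g : Dual K (⋀[K]^n V) := exteriorPower.alternatingMapLinearEquiv D
  have hg : ∀ y : Fin n → V, g (exteriorPower.ιMulti K n y) = D y := fun y =>
    exteriorPower.alternatingMapLinearEquiv_apply_ιMulti D y
  refine ⟨g, ?_, fun c hc y hy => ?_⟩
  · have : (Matrix.of fun k l => ξ l (v k)) = (1 : Matrix (Fin n) (Fin n) K) := by
      ext k l
      simp [hξv, Matrix.one_apply, eq_comm]
    rw [hg, hD, this, Matrix.det_one]
    exact one_ne_zero
  · refine (Submodule.span_le (p := LinearMap.ker g)).2 ?_ hy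
    rintro _ ⟨b, u, hb, hu, rfl⟩
    rw [SetLike.mem_coe, LinearMap.mem_ker, hg, hD, Matrix.det_apply]
    refine Finset.sum_eq_zero fun σ _ => ?_
    have hlt : ∑ l, b (σ l) < ∑ l, a l := by
      rw [Equiv.sum_comp σ b]
      exact hb.trans_lt hc
    obtain ⟨l, -, hl⟩ := Finset.exists_lt_of_sum_lt hlt
    rw [Finset.prod_eq_zero (Finset.mem_univ l), smul_zero]
    exact hξ l _ hl _ (hu _)

end HasWeight

/-! ### Bases adapted to a flag -/

section Adapted

variable {K : Type} [Field K] {V : Type} [AddCommGroup V] [Module K V] {m : ℕ}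

/-- A basis of a subspace `U` adapted to a flag, with dual functionals which are also adapted. -/
structure AdaptedBasis (W : Fin m → Submodule K V) (U : Submodule K V) (n : ℕ) where
  vec : Fin n → V
  idx : Fin n → Fin (m + 1)
  dual : Fin n → Dual K V
  vec_mem : ∀ l, vec l ∈ U
  vec_mem_step : ∀ l, vec l ∈ flagStep W (idx l)
  dual_eq_zero : ∀ l, ∀ i < idx l, ∀ w ∈ flagStep W i, dual l w = 0
  dual_vec : ∀ l k, dual l (vec k) = if l = k then 1 else 0

lemma flagBefore_eq_bot_or {W : Fin m → Submodule K V} (hW : Monotone W) (i : Fin (m + 1)) :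
    flagBefore W i = ⊥ ∨ ∃ l < i, flagBefore W i = flagStep W l := by
  induction i using Fin.cases with
  | zero => exact Or.inl (le_bot_iff.1 (flagBefore_le fun l hl => absurd hl (Fin.not_lt_zero l)))
  | succ j =>
    refine Or.inr ⟨j.castSucc, Fin.castSucc_lt_succ, le_antisymm (flagBefore_le fun l hl => ?_)
      (flagStep_le_flagBefore W Fin.castSucc_lt_succ)⟩
    exact flagStep_mono hW (Fin.le_castSucc_iff.2 hl)

/-- Split off a vector `v₀` of `U` of highest step `j`, together with a functional `ξ₀` that kills
the earlier steps, and recurse on `U ∩ ker ξ₀`. The recursive functionals are corrected by multiples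
of `ξ₀` so that they vanish at `v₀`. -/
lemma exists_adaptedBasis [FiniteDimensional K V] {W : Fin m → Submodule K V} (hW : Monotone W)
    {n : ℕ} (U : Submodule K V) (hU : finrank K U = n) : Nonempty (AdaptedBasis W U n) := by
  induction n generalizing U with
  | zero => exact ⟨⟨nofun, nofun, nofun, nofun, nofun, nofun, nofun⟩⟩
  | succ n ih =>
    obtain ⟨j, hj, hmin⟩ := WellFounded.has_min (wellFounded_lt (α := Fin (m + 1)))
      {i | U ≤ flagStep W i} ⟨Fin.last m, by simp⟩
    have hnot : ¬ U ≤ flagBefore W j := by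
      intro hle
      rcases flagBefore_eq_bot_or hW j with h | ⟨l, hl, h⟩
      · rw [h, le_bot_iff] at hle
        rw [hle, finrank_bot] at hU
        omega
      · exact hmin l (hle.trans h.le) hl
    obtain ⟨v₀, hv₀, hv₀'⟩ := Set.not_subset.1 hnot
    obtain ⟨ξ, hξ, hξ'⟩ := Submodule.exists_dual_map_eq_bot_of_notMem (p := flagBefore W j)
      (x := v₀) hv₀' inferInstance
    have hker : flagBefore W j ≤ LinearMap.ker ξ := LinearMap.le_ker_iff_map.2 hξ'
    let ξ₀ : Dual K V := (ξ v₀)⁻¹ • ξ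
    have hξ₀ : ξ₀ v₀ = 1 := by simp [ξ₀, hξ]
    have hξ₀' : ∀ i < j, ∀ w ∈ flagStep W i, ξ₀ w = 0 := fun i hi w hw => by
      have : ξ w = 0 := hker (flagStep_le_flagBefore W hi hw)
      simp [ξ₀, this]
    let U' : Submodule K V := (LinearMap.ker (ξ₀ ∘ₗ U.subtype)).map U.subtype
    have hU' : finrank K U' = n := by
      have h1 : ξ₀ ∘ₗ U.subtype ≠ 0 := fun h => by
        have h2 : ξ₀ v₀ = 0 := LinearMap.congr_fun h ⟨v₀, hv₀⟩
        exact one_ne_zero (hξ₀.symm.trans h2)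
      have h2 := Module.Dual.finrank_ker_add_one_of_ne_zero h1
      rw [Submodule.finrank_map_subtype_eq]
      omega
    obtain ⟨A⟩ := ih U' hU'
    have hA : ∀ l, A.vec l ∈ U ∧ ξ₀ (A.vec l) = 0 := fun l => by
      obtain ⟨u, hu, he⟩ := A.vec_mem l
      rw [← he]
      exact ⟨u.2, hu⟩
    -- Thus `ξ₀` also vanishes on every step before `A.idx l`, and the correction preserves
    -- adaptedness.
    have hidx : ∀ l, A.idx l ≤ j := fun l => by
      by_contra! hlt
      have := A.dual_eq_zero l j hlt _ (hj (hA l).1)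
      rw [A.dual_vec, if_pos rfl] at this
      exact one_ne_zero this
    refine ⟨⟨Fin.cons v₀ A.vec, Fin.cons j A.idx,
      Fin.cons ξ₀ fun l => A.dual l - A.dual l v₀ • ξ₀, ?_, ?_, ?_, ?_⟩⟩
    · exact Fin.cases hv₀ fun l => (hA l).1
    · exact Fin.cases (hj hv₀) A.vec_mem_step
    · refine Fin.cases hξ₀' fun l i hi w hw => ?_
      simp only [Fin.cons_succ] at hi ⊢
      simp [A.dual_eq_zero l i hi w hw, hξ₀' i (hi.trans_le (hidx l)) w hw]
    · intro l k
      induction l using Fin.cases with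
      | zero =>
        induction k using Fin.cases with
        | zero => simpa using hξ₀
        | succ k => simpa [(Fin.succ_ne_zero k).symm] using (hA k).2
      | succ l =>
        induction k using Fin.cases with
        | zero => simp [hξ₀]
        | succ k => simp [(hA k).2, A.dual_vec]

namespace AdaptedBasis

variable {W : Fin m → Submodule K V} {U : Submodule K V} {n : ℕ} (A : AdaptedBasis W U n)

lemma linearIndependent : LinearIndependent K A.vec := by
  rw [Fintype.linearIndependent_iff]
  intro g hg l
  have := congrArg (A.dual l) hg
  simpa [A.dual_vec] using this

/-- The basis of `U` underlying an adapted basis. -/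
def basis [FiniteDimensional K V] (hU : finrank K U = n) : Basis (Fin n) K U :=
  basisOfLinearIndependentOfCardEqFinrank' (fun l => ⟨A.vec l, A.vec_mem l⟩)
    (LinearIndependent.of_comp U.subtype A.linearIndependent) (by simp [hU])

lemma coe_basis [FiniteDimensional K V] (hU : finrank K U = n) (l : Fin n) :
    (A.basis hU l : V) = A.vec l := by
  simp [basis]

lemma eq_sum [FiniteDimensional K V] (hU : finrank K U = n) {u : V} (hu : u ∈ U) :
    u = ∑ l, A.dual l u • A.vec l := by
  have h1 : u = ∑ l, (A.basis hU).repr ⟨u, hu⟩ l • A.vec l := by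
    have := congrArg Subtype.val ((A.basis hU).sum_repr ⟨u, hu⟩)
    refine this.symm.trans ?_
    simp only [Submodule.coe_sum, Submodule.coe_smul, coe_basis]
  have h2 : ∀ l, A.dual l u = (A.basis hU).repr ⟨u, hu⟩ l := fun l => by
    conv_lhs => rw [h1]
    simp [A.dual_vec]
  simp only [h2]
  exact h1

/-- The coefficients of a vector of `U` are its values under the dual functionals; on `W j` those
with index beyond `j` vanish, so the remaining basis vectors span the intersection. -/
lemma finrank_inf [FiniteDimensional K V] (hW : Monotone W) (hU : finrank K U = n) (j : Fin m) :
    finrank K (U ⊓ W j : Submodule K V) = Fintype.card {l // A.idx l ≤ j.castSucc} := by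
  have h : U ⊓ W j =
      Submodule.span K (Set.range fun l : {l // A.idx l ≤ j.castSucc} => A.vec l) := by
    apply le_antisymm
    · rintro u ⟨hu, huj⟩
      rw [A.eq_sum hU hu]
      refine Submodule.sum_mem _ fun l _ => ?_
      by_cases hl : A.idx l ≤ j.castSucc
      · exact Submodule.smul_mem _ _ (Submodule.subset_span ⟨⟨l, hl⟩, rfl⟩)
      · rw [A.dual_eq_zero l j.castSucc (not_le.1 hl) u (by simpa using huj), zero_smul]
        exact zero_mem _
    · rw [Submodule.span_le]
      rintro _ ⟨⟨l, hl⟩, rfl⟩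
      refine ⟨A.vec_mem l, ?_⟩
      rw [← flagStep_castSucc W j]
      exact flagStep_mono hW hl (A.vec_mem_step l)
  rw [h]
  exact finrank_span_eq_card (A.linearIndependent.comp _ Subtype.val_injective)

lemma sum_flagWeight [FiniteDimensional K V] (hW : Monotone W) (hU : finrank K U = n)
    (α : Fin m → ℚ) : ∑ l, flagWeight W α (A.idx l) =
      ∑ j, (α j : ℝ) * ((finrank K (W j) : ℝ) * n -
        (finrank K V : ℝ) * finrank K (U ⊓ W j : Submodule K V)) := by
  simp only [flagWeight, Finset.sum_sub_distrib, Finset.sum_const, Finset.card_univ,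
    Fintype.card_fin, nsmul_eq_mul, mul_sub]
  congr 1
  · rw [Finset.mul_sum]
    exact Finset.sum_congr rfl fun j _ => by ring
  · simp only [Finset.sum_filter]
    rw [Finset.sum_comm]
    refine Finset.sum_congr rfl fun j _ => ?_
    rw [A.finrank_inf hW hU, Fintype.card_subtype, ← Finset.sum_filter, Finset.sum_const,
      nsmul_eq_mul]
    ring

lemma hasWeight [FiniteDimensional K V] [Nontrivial V] {α : Fin m → ℚ} (hα : ∀ i, 0 < α i) :
    HasWeight (exteriorFiltration n (flagFiltration W α)) (exteriorPower.ιMulti K n A.vec)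
      (∑ l, flagWeight W α (A.idx l)) := by
  refine HasWeight.ιMulti (ξ := A.dual)
    (fun l => flagStep_le_flagFiltration W α le_rfl (A.vec_mem_step l)) (fun l b hb y hy => ?_)
    A.dual_vec
  refine flagFiltration_le (U := LinearMap.ker (A.dual l)) (fun i hi w hw => ?_) hy
  exact A.dual_eq_zero l i ((flagWeight_strictMono W hα).lt_iff_lt.1 (hi.trans_lt hb)) w hw

end AdaptedBasis

/-- Both sides are alternating in `b`, so comparing them on permutations of `e` suffices. -/
lemma alternatingMap_apply_eq_det_smul {K M N : Type} [CommRing K] [AddCommGroup M] [Module K M]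
    [AddCommGroup N] [Module K N] {n : ℕ} (g : M [⋀^Fin n]→ₗ[K] N) (e : Basis (Fin n) K M)
    (b : Fin n → M) : g b = e.det b • g e := by
  let h : M [⋀^Fin n]→ₗ[K] N := (LinearMap.toSpanSingleton K N (g e)).compAlternatingMap e.det
  have : g = h := by
    refine e.ext_alternating fun v hv => ?_
    obtain ⟨σ, rfl⟩ : ∃ σ : Equiv.Perm (Fin n), ⇑σ = v :=
      ⟨Equiv.ofBijective v (Finite.injective_iff_bijective.1 hv), rfl⟩
    change g (e ∘ σ) = e.det (e ∘ σ) • g e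
    rw [g.map_perm, e.det.map_perm, e.det_self, smul_assoc, one_smul]
  rw [this]
  simp [h, e.det_self]

/-- Replacing the given basis of `U` by an adapted one rescales the wedge by a nonzero determinant,
which leaves the weight unchanged. -/
lemma hasWeight_ιMulti_basis [FiniteDimensional K V] [Nontrivial V] {W : Fin m → Submodule K V}
    (hW : Monotone W) {α : Fin m → ℚ} (hα : ∀ i, 0 < α i) {U : Submodule K V} {n : ℕ}
    (b : Basis (Fin n) K U) :
    HasWeight (exteriorFiltration n (flagFiltration W α))
      (exteriorPower.ιMulti K n fun l => (b l : V))
      (∑ j, (α j : ℝ) * ((finrank K (W j) : ℝ) * n -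
        (finrank K V : ℝ) * finrank K (U ⊓ W j : Submodule K V))) := by
  have hU : finrank K U = n := by simp [finrank_eq_card_basis b]
  obtain ⟨A⟩ := exists_adaptedBasis hW U hU
  have h := alternatingMap_apply_eq_det_smul ((exteriorPower.ιMulti K n).compLinearMap U.subtype)
    (A.basis hU) b
  have h1 : exteriorPower.ιMulti K n (fun l => (b l : V)) =
      (A.basis hU).det b • exteriorPower.ιMulti K n A.vec := by
    refine h.trans ?_
    have h2 : (fun l => (A.basis hU l : V)) = A.vec := funext fun l => A.coe_basis hU l
    rw [← h2]
    rfl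
  rw [h1, ← A.sum_flagWeight hW hU]
  exact (A.hasWeight hα).smul ((A.basis hU).isUnit_det b).ne_zero

end Adapted

/-! ### Specialization to the generic point -/

section Generic

variable {X : Scheme.{0}} [IsIntegral X]

/-- The inclusion of a local ring into the function field. -/
def toField (x : X) : X.presheaf.stalk x →+* X.presheaf.stalk (genericPoint X) :=
  (X.presheaf.stalkSpecializes (genericPoint_specializes x)).hom

lemma toField_injective (x : X) : Function.Injective (toField x) :=
  IsFractionRing.injective (X.presheaf.stalk x) X.functionField

lemma toField_eq_zero {x : X} {a : X.presheaf.stalk x} : toField x a = 0 ↔ a = 0 :=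
  map_eq_zero_iff _ (toField_injective x)

/-- The map from a stalk to the generic stalk. -/
def toGenericStalk (M : X.Modules) (x : X) : Stalk M x →+ Stalk M (genericPoint X) :=
  specialize M (genericPoint_specializes x)

lemma toGenericStalk_smul (M : X.Modules) (x : X) (a : X.presheaf.stalk x) (s : Stalk M x) :
    toGenericStalk M x (a • s) = toField x a • toGenericStalk M x s :=
  specialize_smul M _ a s

lemma genericPoint_mem {U : X.Opens} {x : X} (hx : x ∈ U) : genericPoint X ∈ U :=
  (genericPoint_specializes x).mem_open U.2 hx

lemma toGenericStalk_germ (M : X.Modules) {x : X} {U : X.Opens} (hx : x ∈ U) (s : Γ(M, U)) :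
    toGenericStalk M x (germ M x hx s) = germ M (genericPoint X) (genericPoint_mem hx) s :=
  specialize_germ M _ hx s

lemma toGenericStalk_genericPoint (M : X.Modules) (s : Stalk M (genericPoint X)) :
    toGenericStalk M (genericPoint X) s = s := by
  obtain ⟨U, hU, t, rfl⟩ := exists_germ M _ s
  exact toGenericStalk_germ M hU t

end Generic

/-! ### Frames -/

section Frames

lemma IsFrame.basis_apply {X : Scheme.{0}} {M : X.Modules} {U : X.Opens} {n : ℕ}
    {e : Fin n → Γ(M, U)} (he : IsFrame M e) (x : X) (hx : x ∈ U) (i : Fin n) :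
    he.basis x hx i = germ M x hx (e i) :=
  Basis.mk_apply _ _ i

lemma IsFrame.of_isUnit_det {X : Scheme.{0}} {M : X.Modules} {U V : X.Opens} {n : ℕ}
    {e : Fin n → Γ(M, U)} (he : IsFrame M e) (hVU : V ≤ U) {t : Fin n → Γ(M, V)}
    (h : ∀ (y : X) (hy : y ∈ V), IsUnit ((he.basis y (hVU hy)).det fun i => germ M y hy (t i))) :
    IsFrame M t where
  linearIndependent y hy := ((Basis.is_basis_iff_det _).2 (h y hy)).1
  span_eq_top y hy := ((Basis.is_basis_iff_det _).2 (h y hy)).2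

/-- Spread the basis out to sections and shrink to the locus where their determinant against an
existing frame is a unit. -/
lemma VectorBundle.exists_frame_of_basis {X : Scheme.{0}} {r : ℕ} (E : VectorBundle X r) (x : X)
    (b : Basis (Fin r) (X.presheaf.stalk x) (Stalk E.sheaf x)) :
    ∃ (U : X.Opens) (hx : x ∈ U) (t : Fin r → Γ(E.sheaf, U)), IsFrame E.sheaf t ∧
      ∀ i, germ E.sheaf x hx (t i) = b i := by
  obtain ⟨U, hxU, e, he⟩ := E.exists_frame x
  choose V hV t ht using fun i => exists_germ E.sheaf x (b i)
  choose W hW hWV f hf using fun i j => exists_coord_section he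
    (V := V j ⊓ U) inf_le_right (E.sheaf.presheaf.map (homOfLE inf_le_left).op (t j)) x
    ⟨hV j, hxU⟩ i
  let W₀ : X.Opens := (Finset.univ.inf fun p : Fin r × Fin r => W p.1 p.2) ⊓
    (Finset.univ.inf V ⊓ U)
  have hxW : x ∈ W₀ := by
    refine ⟨?_, ?_, hxU⟩
    · rw [TopologicalSpace.Opens.coe_finset_inf]
      simpa using fun i j => hW i j
    · rw [TopologicalSpace.Opens.coe_finset_inf]
      simpa using hV
  have hle : ∀ i j, W₀ ≤ W i j := fun i j =>
    inf_le_left.trans (Finset.inf_le (f := fun p : Fin r × Fin r => W p.1 p.2)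
      (Finset.mem_univ (i, j)))
  have hleV : ∀ j, W₀ ≤ V j := fun j =>
    inf_le_right.trans (inf_le_left.trans (Finset.inf_le (Finset.mem_univ j)))
  have hleU : W₀ ≤ U := inf_le_right.trans inf_le_right
  let A : Matrix (Fin r) (Fin r) Γ(X, W₀) :=
    Matrix.of fun i j => X.presheaf.map (homOfLE (hle i j)).op (f i j)
  have hA : ∀ (y : X) (hy : y ∈ W₀), (he.basis y (hleU hy)).det
      (fun j => germ E.sheaf y (hleV j hy) (t j)) = X.presheaf.germ W₀ y hy A.det := by
    intro y hy
    rw [Basis.det_apply]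
    refine Eq.trans ?_ (RingHom.map_det (X.presheaf.germ W₀ y hy).hom A).symm
    congr 1
    ext i j
    have h1 := hf i j y (hle i j hy)
    rw [germ_res] at h1
    rw [Basis.toMatrix_apply]
    refine Eq.trans h1 ?_
    exact (TopCat.Presheaf.germ_res_apply X.presheaf (homOfLE (hle i j)) y hy (f i j)).symm
  let D : X.Opens := X.basicOpen A.det
  have hxD : x ∈ D := by
    rw [Scheme.mem_basicOpen _ _ _ hxW, ← hA x hxW]
    simp only [ht]
    exact Basis.isUnit_det _ b
  have hDW : D ≤ W₀ := X.basicOpen_le _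
  refine ⟨D, hxD, fun j => E.sheaf.presheaf.map (homOfLE (hDW.trans (hleV j))).op (t j),
    he.of_isUnit_det (hDW.trans hleU) fun y hy => ?_, fun i => ?_⟩
  · simp only [germ_res]
    rw [hA y (hDW hy)]
    exact (Scheme.mem_basicOpen _ _ _ (hDW hy)).1 hy
  · rw [germ_res, ht]

lemma mem_span_castLE_iff {R M : Type} [CommRing R] [AddCommGroup M] [Module R M] {r s : ℕ}
    (b : Basis (Fin r) R M) (hs : s ≤ r) {v : M} :
    v ∈ Submodule.span R (Set.range fun i : Fin s => b (Fin.castLE hs i)) ↔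
      ∀ i : Fin r, s ≤ i → b.repr v i = 0 := by
  have : (Set.range fun i : Fin s => b (Fin.castLE hs i)) = b '' {i | i.val < s} := by
    ext w
    constructor
    · rintro ⟨i, rfl⟩
      exact ⟨_, i.2, rfl⟩
    · rintro ⟨i, hi, rfl⟩
      exact ⟨⟨i, hi⟩, rfl⟩
  rw [this, Basis.mem_span_image]
  constructor
  · intro h i hi
    by_contra hne
    exact absurd (h (Finsupp.mem_support_iff.2 hne)) (not_lt.2 hi)
  · intro h i hi
    by_contra hlt
    exact Finsupp.mem_support_iff.1 hi (h i (not_lt.1 hlt))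

variable {X : Scheme.{0}} [IsIntegral X]

lemma IsFrame.repr_toGenericStalk {M : X.Modules} {U : X.Opens} {n : ℕ}
    {e : Fin n → Γ(M, U)} (he : IsFrame M e) {x : X} (hx : x ∈ U) (s : Stalk M x) (i : Fin n) :
    (he.basis (genericPoint X) (genericPoint_mem hx)).repr (toGenericStalk M x s) i =
      toField x ((he.basis x hx).repr s i) := by
  conv_lhs => rw [← (he.basis x hx).sum_repr s]
  simp only [map_sum, toGenericStalk_smul, IsFrame.basis_apply, toGenericStalk_germ]
  simp only [← he.basis_apply _ (genericPoint_mem hx), map_smul, Basis.repr_self]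
  simp [Finsupp.single_apply]

/-- Membership is the vanishing of the last frame coordinates, which can be tested in the function
field because the local ring injects into it. -/
lemma IsFrame.mem_span_iff {M : X.Modules} {U : X.Opens} {n k : ℕ} (hk : k ≤ n)
    {e : Fin n → Γ(M, U)} (he : IsFrame M e) {x : X} (hx : x ∈ U) (s : Stalk M x) :
    s ∈ Submodule.span (X.presheaf.stalk x)
        (Set.range fun i : Fin k => germ M x hx (e (Fin.castLE hk i))) ↔
      toGenericStalk M x s ∈ Submodule.span (X.presheaf.stalk (genericPoint X))
        (Set.range fun i : Fin k => germ M _ (genericPoint_mem hx) (e (Fin.castLE hk i))) := by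
  simp only [← he.basis_apply]
  rw [mem_span_castLE_iff, mem_span_castLE_iff]
  simp only [he.repr_toGenericStalk hx, toField_eq_zero]

variable {r : ℕ} (E : VectorBundle X r)

lemma VectorBundle.toGenericStalk_injective (x : X) :
    Function.Injective (toGenericStalk E.sheaf x) := by
  rw [injective_iff_map_eq_zero]
  intro s hs
  obtain ⟨U, hx, e, he⟩ := E.exists_frame x
  refine (he.basis x hx).ext_elem fun i => ?_
  have := he.repr_toGenericStalk hx s i
  rw [hs, map_zero, Finsupp.zero_apply, eq_comm, toField_eq_zero] at this
  rw [this, map_zero, Finsupp.zero_apply]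

lemma VectorBundle.exists_smul_mem_range (x : X) (w : Stalk E.sheaf (genericPoint X)) :
    ∃ (d : X.presheaf.stalk x) (v : Stalk E.sheaf x), d ≠ 0 ∧
      toGenericStalk E.sheaf x v = toField x d • w := by
  obtain ⟨U, hx, e, he⟩ := E.exists_frame x
  obtain ⟨d, hd⟩ := IsLocalization.exist_integer_multiples_of_finite
    (nonZeroDivisors (X.presheaf.stalk x)) (S := X.functionField)
    (fun i => (he.basis _ (genericPoint_mem hx)).repr w i)
  choose c hc using hd
  refine ⟨d, ∑ i, c i • he.basis x hx i, nonZeroDivisors.coe_ne_zero d, ?_⟩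
  conv_rhs => rw [← (he.basis _ (genericPoint_mem hx)).sum_repr w, Finset.smul_sum]
  rw [map_sum]
  refine Finset.sum_congr rfl fun i _ => ?_
  rw [toGenericStalk_smul, IsFrame.basis_apply, toGenericStalk_germ, IsFrame.basis_apply, smul_smul]
  congr 1
  refine (hc i).trans ?_
  exact Algebra.smul_def _ _

variable {E}

/-- A subbundle is saturated, hence determined by its generic stalk. -/
lemma Subbundle.mem_stalk_iff (F : Subbundle E) {x : X} {s : Stalk E.sheaf x} :
    s ∈ F.stalk x ↔ toGenericStalk E.sheaf x s ∈ F.stalk (genericPoint X) := by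
  obtain ⟨U, hx, e, he, h⟩ := F.locally_spanned x
  rw [h x hx, h _ (genericPoint_mem hx)]
  exact he.mem_span_iff F.rank_le hx s

end Frames

/-! ### Ranks of subbundles and their fibres -/

section Ranks

variable {X : Scheme.{0}} {r : ℕ} {E : VectorBundle X r}

lemma VectorBundle.nonempty_basis (E : VectorBundle X r) (x : X) :
    Nonempty (Basis (Fin r) (X.presheaf.stalk x) (Stalk E.sheaf x)) := by
  obtain ⟨U, hx, e, he⟩ := E.exists_frame x
  exact ⟨he.basis x hx⟩

lemma Subbundle.finrank_stalk (F : Subbundle E) (x : X) :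
    finrank (X.presheaf.stalk x) (F.stalk x) = F.rank := by
  rw [finrank_eq_card_basis (F.stalkBasis x), Fintype.card_fin]

lemma VectorBundle.finrank_stalk (E : VectorBundle X r) (x : X) :
    finrank (X.presheaf.stalk x) (Stalk E.sheaf x) = r := by
  rw [finrank_eq_card_basis (E.nonempty_basis x).some, Fintype.card_fin]

lemma VectorBundle.finite_stalk (E : VectorBundle X r) (x : X) :
    Module.Finite (X.presheaf.stalk x) (Stalk E.sheaf x) :=
  Module.Finite.of_basis (E.nonempty_basis x).some

lemma VectorBundle.finite_fibre (E : VectorBundle X r) (x : X) :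
    Module.Finite (Kappa x) (Fibre E.sheaf x) :=
  Module.Finite.of_basis ((E.nonempty_basis x).some.baseChange (Kappa x))

lemma VectorBundle.finrank_fibre (E : VectorBundle X r) (x : X) :
    finrank (Kappa x) (Fibre E.sheaf x) = r := by
  rw [finrank_eq_card_basis ((E.nonempty_basis x).some.baseChange (Kappa x)), Fintype.card_fin]

lemma Subbundle.finrank_fibre (F : Subbundle E) (x : X) :
    finrank (Kappa x) (F.fibre x) = F.rank := by
  obtain ⟨U, hx, e, he, h⟩ := F.locally_spanned x
  let b := (he.basis x hx).baseChange (Kappa x)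
  have hF : F.fibre x =
      Submodule.span (Kappa x) (Set.range fun i => b (Fin.castLE F.rank_le i)) := by
    rw [Subbundle.fibre, h x hx, Submodule.baseChange_span, ← Set.range_comp]
    congr 2
    funext i
    simp [b, he.basis_apply]
  have hli : LinearIndependent (Kappa x) fun i => b (Fin.castLE F.rank_le i) :=
    b.linearIndependent.comp _ (Fin.castLE_injective F.rank_le)
  rw [hF, finrank_span_eq_card hli, Fintype.card_fin]

end Ranks

/-! ### Saturation of a subspace of the generic stalk -/

section Saturation

variable {X : Scheme.{0}} [IsIntegral X] {r : ℕ} (E : VectorBundle X r)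

/-- The elements of a stalk which lie in a given subspace of the generic stalk. -/
def saturatedStalk (W : Submodule (X.presheaf.stalk (genericPoint X))
    (Stalk E.sheaf (genericPoint X))) (x : X) :
    Submodule (X.presheaf.stalk x) (Stalk E.sheaf x) where
  carrier := {s | toGenericStalk E.sheaf x s ∈ W}
  add_mem' := fun {a b} ha hb => by
    rw [Set.mem_ofPred_eq, map_add]
    exact add_mem ha hb
  zero_mem' := by
    rw [Set.mem_ofPred_eq, map_zero]
    exact zero_mem _
  smul_mem' a s hs := by
    rw [Set.mem_ofPred_eq, toGenericStalk_smul]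
    exact Submodule.smul_mem _ _ hs

variable {E} {W : Submodule (X.presheaf.stalk (genericPoint X)) (Stalk E.sheaf (genericPoint X))}

lemma mem_saturatedStalk {x : X} {s : Stalk E.sheaf x} :
    s ∈ saturatedStalk E W x ↔ toGenericStalk E.sheaf x s ∈ W := Iff.rfl

/-- Clearing denominators in a basis of `W` gives that many independent elements of the saturated
stalk. -/
lemma finrank_le_of_basis_saturatedStalk {x : X} {n : ℕ}
    (b : Basis (Fin n) (X.presheaf.stalk x) (saturatedStalk E W x)) :
    finrank X.functionField W ≤ n := by
  have hfin := E.finite_stalk (genericPoint X)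
  have : Module.Finite X.functionField W :=
    FiniteDimensional.finiteDimensional_submodule (K := X.functionField) W
  let w := finBasis X.functionField W
  choose d v hd hv using fun i => E.exists_smul_mem_range x (w i).1
  have hvW : ∀ i, v i ∈ saturatedStalk E W x := fun i => by
    rw [mem_saturatedStalk, hv]
    exact Submodule.smul_mem _ _ (w i).2
  have hli : LinearIndependent (X.presheaf.stalk x)
      fun i => (⟨v i, hvW i⟩ : saturatedStalk E W x) := by
    rw [Fintype.linearIndependent_iff]
    intro g hg i
    have h1 : ∑ i, g i • v i = 0 := by
      simpa using congrArg Subtype.val hg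
    have h2 : ∑ i, (toField x (g i) * toField x (d i)) • (w i).1 = 0 := by
      have := congrArg (toGenericStalk E.sheaf x) h1
      simpa [map_sum, toGenericStalk_smul, hv, smul_smul] using this
    have h3 : ∑ i, (toField x (g i) * toField x (d i) : X.functionField) • w i = 0 :=
      Subtype.ext (by simpa using h2)
    have h4 := Fintype.linearIndependent_iff.1 w.linearIndependent _ h3 i
    rw [← map_mul, toField_eq_zero] at h4
    exact (mul_eq_zero.1 h4).resolve_right (hd i)
  have := Module.Finite.of_basis b
  have := hli.fintype_card_le_finrank
  simpa [finrank_eq_card_basis b] using this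

/-- Smith normal form supplies a basis of `E_x` with nonzero multiples of some members in the
saturated stalk; by saturation those members themselves lie in it. The permutation `σ` moves `s` of
them to the front. -/
lemma exists_basis_saturatedStalk (x : X) [IsPrincipalIdealRing (X.presheaf.stalk x)]
    {s : ℕ} (hs : s ≤ r) (hW : finrank X.functionField W = s) :
    ∃ b : Basis (Fin r) (X.presheaf.stalk x) (Stalk E.sheaf x),
      ∀ i : Fin s, b (Fin.castLE hs i) ∈ saturatedStalk E W x := by
  obtain ⟨n, S⟩ := Submodule.smithNormalForm (E.nonempty_basis x).some (saturatedStalk E W x)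
  have hsn : s ≤ n := hW ▸ finrank_le_of_basis_saturatedStalk S.bN
  obtain ⟨σ, hσ⟩ := Equiv.Perm.exists_extending_pair (fun i : Fin s => Fin.castLE hs i)
    (fun i => S.f (Fin.castLE hsn i)) (Fin.castLE_injective hs)
    (S.f.injective.comp (Fin.castLE_injective hsn))
  refine ⟨S.bM.reindex σ.symm, fun i => ?_⟩
  rw [Basis.reindex_apply, Equiv.symm_symm, hσ]
  set k := Fin.castLE hsn i
  have ha : S.a k ≠ 0 := fun h => by
    have h1 := S.snf k
    rw [h, zero_smul] at h1
    exact S.bN.ne_zero k (Subtype.ext h1)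
  have h2 : toField x (S.a k) • toGenericStalk E.sheaf x (S.bM (S.f k)) ∈ W := by
    rw [← toGenericStalk_smul, ← S.snf]
    exact (S.bN k).2
  have ha' : (toField x (S.a k) : X.functionField) ≠ 0 := fun h => ha (toField_eq_zero.1 h)
  exact (Submodule.smul_mem_iff (R := X.functionField) W ha').1 h2

/-- The subbundle generated by a subspace of the generic stalk. -/
def saturation (W : Submodule (X.presheaf.stalk (genericPoint X))
    (Stalk E.sheaf (genericPoint X))) (hX : ∀ x : X, IsPrincipalIdealRing (X.presheaf.stalk x)) :
    Subbundle E where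
  rank := finrank (X.presheaf.stalk (genericPoint X)) W
  rank_le := by
    have := E.finite_stalk (genericPoint X)
    have h := Submodule.finrank_le (R := X.functionField) W
    exact h.trans (E.finrank_stalk _).le
  stalk := saturatedStalk E W
  locally_spanned x := by
    have := hX x
    have hfin := E.finite_stalk (genericPoint X)
    have hle : finrank (X.presheaf.stalk (genericPoint X)) W ≤ r :=
      (Submodule.finrank_le (R := X.functionField) W).trans (E.finrank_stalk _).le
    obtain ⟨b, hb⟩ := exists_basis_saturatedStalk (E := E) (W := W) x hle rfl
    obtain ⟨U, hx, t, ht, htb⟩ := E.exists_frame_of_basis x b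
    refine ⟨U, hx, t, ht, fun y hy => ?_⟩
    -- The first members of the frame span `W` generically by a dimension count;
    -- `IsFrame.mem_span_iff` then carries this to every point of `U`.
    have hspan : Submodule.span (X.presheaf.stalk (genericPoint X))
        (Set.range fun i => germ E.sheaf _ (genericPoint_mem hx) (t (Fin.castLE hle i))) = W := by
      have hfinW : Module.Finite X.functionField W :=
    FiniteDimensional.finiteDimensional_submodule (K := X.functionField) W
      refine Submodule.eq_of_le_of_finrank_eq (K := X.functionField) ?_ ?_
      · rw [Submodule.span_le]
        rintro _ ⟨i, rfl⟩
        have := mem_saturatedStalk.1 (hb i)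
        rwa [← htb, toGenericStalk_germ] at this
      · have hli := (ht.linearIndependent _ (genericPoint_mem hx)).comp _ (Fin.castLE_injective hle)
        refine (finrank_span_eq_card (R := X.functionField) hli).trans ?_
        rw [Fintype.card_fin]
    ext v
    rw [ht.mem_span_iff hle hy, mem_saturatedStalk]
    exact iff_of_eq (congrArg (toGenericStalk E.sheaf y v ∈ ·) hspan.symm)

lemma saturation_stalk_genericPoint
    (hX : ∀ x : X, IsPrincipalIdealRing (X.presheaf.stalk x)) :
    (saturation W hX).stalk (genericPoint X) = W := by
  ext v
  refine mem_saturatedStalk.trans ?_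
  rw [toGenericStalk_genericPoint]

end Saturation

/-! ### Tensoring with a line -/

section Line

variable {R M N : Type} [CommRing R] [AddCommGroup M] [Module R M] [AddCommGroup N] [Module R N]
  (b : Basis (Fin 1) R N)

/-- The isomorphism `M ⊗ N ≅ M` given by a generator of the line `N`. -/
def contractLine : M ⊗[R] N →ₗ[R] M :=
  (TensorProduct.rid R M).toLinearMap ∘ₗ LinearMap.lTensor M (b.coord 0)

@[simp] lemma contractLine_tmul (a : M) (c : N) : contractLine b (a ⊗ₜ c) = b.repr c 0 • a := by
  simp [contractLine]

lemma repr_smul_basis_zero (c : N) : b.repr c 0 • b 0 = c := by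
  simpa using b.sum_repr c

lemma contractLine_tmul_basis (t : M ⊗[R] N) : contractLine b t ⊗ₜ b 0 = t := by
  induction t with
  | zero => simp
  | tmul a c =>
    rw [contractLine_tmul, TensorProduct.smul_tmul, repr_smul_basis_zero]
  | add s t hs ht => rw [map_add, TensorProduct.add_tmul, hs, ht]

lemma contractLine_eq_zero {t : M ⊗[R] N} : contractLine b t = 0 ↔ t = 0 := by
  refine ⟨fun h => ?_, fun h => by rw [h, map_zero]⟩
  rw [← contractLine_tmul_basis b t, h, TensorProduct.zero_tmul]

lemma contractLine_change (b' : Basis (Fin 1) R N) (t : M ⊗[R] N) :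
    contractLine b t = b.repr (b' 0) 0 • contractLine b' t := by
  conv_lhs => rw [← contractLine_tmul_basis b' t, contractLine_tmul]

lemma mem_range_map_subtype_iff (F : Submodule R M) (t : M ⊗[R] N) :
    t ∈ LinearMap.range (TensorProduct.map F.subtype (LinearMap.id : N →ₗ[R] N)) ↔
      contractLine b t ∈ F := by
  constructor
  · rintro ⟨u, rfl⟩
    induction u with
    | zero => simp
    | tmul a c =>
      rw [TensorProduct.map_tmul, contractLine_tmul]
      exact F.smul_mem _ a.2
    | add s t hs ht => rw [map_add, map_add]; exact F.add_mem hs ht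
  · intro h
    refine ⟨⟨_, h⟩ ⊗ₜ b 0, ?_⟩
    simp only [TensorProduct.map_tmul]
    exact contractLine_tmul_basis b t

end Line

/-! ### Twisted endomorphisms as endomorphisms of the stalks -/

section LocalEnd

variable {X : Scheme.{0}} {E L : X.Modules} (phi : TwistedEnd E L)

/-- The endomorphism of a stalk given by a twisted endomorphism and a generator of the stalk of
the twisting line bundle. -/
def TwistedEnd.localEnd (x : X) (b : Basis (Fin 1) (X.presheaf.stalk x) (Stalk L x)) :
    Stalk E x →ₗ[X.presheaf.stalk x] Stalk E x :=
  contractLine b ∘ₗ phi.map x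

lemma TwistedEnd.map_eq (x : X) (b : Basis (Fin 1) (X.presheaf.stalk x) (Stalk L x))
    (v : Stalk E x) : phi.map x v = phi.localEnd x b v ⊗ₜ b 0 :=
  (contractLine_tmul_basis b _).symm

lemma TwistedEnd.localEnd_eq_zero_iff (x : X)
    (b : Basis (Fin 1) (X.presheaf.stalk x) (Stalk L x)) :
    phi.localEnd x b = 0 ↔ phi.map x = 0 := by
  simp only [LinearMap.ext_iff, TwistedEnd.localEnd, LinearMap.comp_apply, contractLine_eq_zero,
    LinearMap.zero_apply]

lemma TwistedEnd.localEnd_change (x : X) (b b' : Basis (Fin 1) (X.presheaf.stalk x) (Stalk L x)) :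
    phi.localEnd x b = b.repr (b' 0) 0 • phi.localEnd x b' :=
  LinearMap.ext fun _ => contractLine_change b b' _

/-- Here `t` is the `n`-th tensor power of the generator, and `τ` certifies that tensoring with `t`
loses nothing, so the twisted iterate vanishes exactly when the power of the local endomorphism
does. -/
lemma TwistedEnd.exists_iterate_eq (x : X)
    (b : Basis (Fin 1) (X.presheaf.stalk x) (Stalk L x)) (n : ℕ) :
    ∃ (t : ⨂[X.presheaf.stalk x]^n (Stalk L x))
      (τ : (⨂[X.presheaf.stalk x]^n (Stalk L x)) →ₗ[X.presheaf.stalk x] X.presheaf.stalk x),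
      τ t = 1 ∧ ∀ v, phi.iterate x n v = ((phi.localEnd x b) ^ n) v ⊗ₜ t := by
  induction n with
  | zero =>
    exact ⟨TensorPower.algebraMap₀ (R := X.presheaf.stalk x) (M := Stalk L x) 1,
      (TensorPower.algebraMap₀ (R := X.presheaf.stalk x) (M := Stalk L x)).symm.toLinearMap,
      by simp, fun v => by simp [TwistedEnd.iterate]⟩
  | succ n ih =>
    obtain ⟨t, τ, hτ, h⟩ := ih
    let sub := PiTensorProduct.subsingletonEquiv (R := X.presheaf.stalk x)
              (s := fun _ : Fin 1 => Stalk L x) (0 : Fin 1)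
    let mulE := TensorPower.mulEquiv (R := X.presheaf.stalk x) (M := Stalk L x)
            (n := n) (m := 1)
    refine ⟨mulE (t ⊗ₜ sub.symm (b 0)),
      (TensorProduct.lid _ _).toLinearMap ∘ₗ TensorProduct.map τ (b.coord 0 ∘ₗ sub.toLinearMap) ∘ₗ
        mulE.symm.toLinearMap, ?_, fun v => ?_⟩
    · simp [hτ]
    · rw [TwistedEnd.iterate]
      simp only [LinearMap.comp_apply, phi.map_eq x b v, LinearMap.rTensor_tmul, h,
        LinearEquiv.coe_coe, TensorProduct.assoc_tmul, LinearMap.lTensor_tmul]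
      rw [pow_succ]
      rfl

lemma TwistedEnd.iterate_eq_zero_iff (x : X)
    (b : Basis (Fin 1) (X.presheaf.stalk x) (Stalk L x)) (n : ℕ) :
    phi.iterate x n = 0 ↔ (phi.localEnd x b) ^ n = 0 := by
  obtain ⟨t, τ, hτ, h⟩ := phi.exists_iterate_eq x b n
  constructor
  · intro h0
    refine LinearMap.ext fun v => ?_
    have h1 := congrArg ((TensorProduct.rid _ _).toLinearMap ∘ₗ LinearMap.lTensor _ τ) (h v)
    rw [h0] at h1
    simpa [hτ] using h1.symm
  · intro h0
    refine LinearMap.ext fun v => ?_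
    rw [h, h0, LinearMap.zero_apply, TensorProduct.zero_tmul, LinearMap.zero_apply]

variable [IsIntegral X]

/-- The local expression `∑ a_i ⊗ b_i` is valid on an open set, which also contains the generic
point; this ties the stalk maps of `phi` together. -/
lemma TwistedEnd.toGenericStalk_localEnd {U : X.Opens} {e : Fin 1 → Γ(L, U)} (he : IsFrame L e)
    {x : X} (hx : x ∈ U) (v : Stalk E x) :
    toGenericStalk E x (phi.localEnd x (he.basis x hx) v) =
      phi.localEnd _ (he.basis _ (genericPoint_mem hx)) (toGenericStalk E x v) := by
  obtain ⟨U', hxU', s, rfl⟩ := exists_germ E x v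
  obtain ⟨V, hxV, hVU, n, a, c, h⟩ := phi.locally_section U' s x hxU'
  rw [toGenericStalk_germ]
  simp only [TwistedEnd.localEnd, LinearMap.comp_apply]
  rw [h x hxV, h _ (genericPoint_mem hxV)]
  simp only [map_sum, contractLine_tmul, toGenericStalk_smul, toGenericStalk_germ]
  refine Finset.sum_congr rfl fun i _ => ?_
  rw [← he.repr_toGenericStalk hx, toGenericStalk_germ]

end LocalEnd

/-! ### Testing vanishing, nilpotency and invariance at the generic point -/

section Generic

variable {X : Scheme.{0}} [IsIntegral X] {r : ℕ} {E : VectorBundle X r} {L : VectorBundle X 1}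
  (phi : TwistedEnd E.sheaf L.sheaf)
  (b : Basis (Fin 1) (X.presheaf.stalk (genericPoint X)) (Stalk L.sheaf (genericPoint X)))

/-- A local generator of `L` near `x` differs generically from `b` by a scalar, which is `c`. -/
lemma TwistedEnd.exists_localEnd (x : X) :
    ∃ (b' : Basis (Fin 1) (X.presheaf.stalk x) (Stalk L.sheaf x))
      (c : X.presheaf.stalk (genericPoint X)), ∀ v,
      toGenericStalk E.sheaf x (phi.localEnd x b' v) =
        c • phi.localEnd _ b (toGenericStalk E.sheaf x v) := by
  obtain ⟨U, hx, e, he⟩ := L.exists_frame x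
  refine ⟨he.basis x hx, (he.basis _ (genericPoint_mem hx)).repr (b 0) 0, fun v => ?_⟩
  rw [phi.toGenericStalk_localEnd he hx, phi.localEnd_change _ _ b]
  rfl

lemma TwistedEnd.localEnd_genericPoint_eq_zero (h : phi.localEnd _ b = 0) (x : X) :
    phi.map x = 0 := by
  obtain ⟨b', c, hc⟩ := phi.exists_localEnd b x
  rw [← phi.localEnd_eq_zero_iff x b']
  refine LinearMap.ext fun v => E.toGenericStalk_injective x ?_
  rw [hc, h]
  simp

lemma TwistedEnd.isNilpotent_iff : phi.IsNilpotent ↔ ∃ n, phi.localEnd _ b ^ n = 0 := by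
  constructor
  · rintro ⟨n, hn⟩
    exact ⟨n, (phi.iterate_eq_zero_iff _ b n).1 (hn _)⟩
  · rintro ⟨n, hn⟩
    refine ⟨n, fun x => ?_⟩
    obtain ⟨b', c, hc⟩ := phi.exists_localEnd b x
    rw [phi.iterate_eq_zero_iff x b']
    have key : ∀ k v, toGenericStalk E.sheaf x ((phi.localEnd x b' ^ k) v) =
        c ^ k • (phi.localEnd _ b ^ k) (toGenericStalk E.sheaf x v) := by
      intro k
      induction k with
      | zero => simp
      | succ k ih =>
        intro v
        rw [pow_succ, Module.End.mul_apply, ih, hc, map_smul, smul_smul, ← pow_succ, pow_succ,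
          pow_succ, Module.End.mul_apply]
    refine LinearMap.ext fun v => E.toGenericStalk_injective x ?_
    rw [key, hn]
    simp

/-- The scalar relating the local and generic endomorphisms preserves subspaces, and saturation of
`F` brings generic membership back to each stalk. -/
lemma Subbundle.isInvariant_iff (F : Subbundle E) :
    F.IsInvariant phi ↔ ∀ v ∈ F.stalk (genericPoint X), phi.localEnd _ b v ∈
      F.stalk (genericPoint X) := by
  constructor
  · intro h v hv
    exact (mem_range_map_subtype_iff b _ _).1 (h _ v hv)
  · intro h x v hv
    obtain ⟨b', c, hc⟩ := phi.exists_localEnd b x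
    refine (mem_range_map_subtype_iff b' _ _).2 (F.mem_stalk_iff.2 ?_)
    have h1 := hc v
    refine (congrArg (· ∈ F.stalk (genericPoint X)) h1).mpr ?_
    exact Submodule.smul_mem _ _ (h _ (F.mem_stalk_iff.1 hv))

end Generic

/-! ### Numerical preparations -/

lemma ParabolicType.z_ne_zero {r : ℕ} (P : ParabolicType r) : P.z ≠ 0 := by
  simp [ParabolicType.z, Finset.lcm_eq_zero_iff]

/-- As `z` clears the denominators and the weights are positive, the floor is exact. -/
lemma ParabolicType.mult_eq {r : ℕ} (P : ParabolicType r) (i : Fin P.k) :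
    (P.mult i : ℚ) = P.z * P.weight i := by
  obtain ⟨q, hq⟩ : (P.weight i).den ∣ P.z := Finset.dvd_lcm (Finset.mem_univ i)
  have hn : ((P.weight i).num.toNat : ℚ) = (P.weight i).num := by
    exact_mod_cast Int.toNat_of_nonneg (Rat.num_pos.2 (P.weight_pos i)).le
  have h : (P.z : ℚ) * P.weight i = ((q * (P.weight i).num.toNat : ℕ) : ℚ) := by
    rw [hq]
    push_cast
    rw [hn, mul_assoc, mul_comm (q : ℚ), ← mul_assoc, mul_comm _ (P.weight i),
      Rat.mul_den_eq_num, mul_comm]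
  rw [ParabolicType.mult, h, Nat.floor_natCast]

lemma ParabolicType.sum_index {r : ℕ} (P : ParabolicType r) (g : Fin P.k → ℝ) :
    ∑ p : P.Index, g p.1 = ∑ i, (P.mult i : ℝ) * g i := by
  rw [Fintype.sum_sigma]
  simp

/-- An affine function of `δ` is eventually governed by its slope, and by its constant term if the
slope vanishes. -/
lemma asymptotically_nonneg_iff (a μ b : ℝ) :
    (∃ c : ℚ, 0 < c ∧ ∀ δ : ℚ, c ≤ δ → 0 ≤ a + (δ : ℝ) * μ + b) ↔
      0 < μ ∨ (μ = 0 ∧ 0 ≤ a + b) := by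
  constructor
  · rintro ⟨c, hc, h⟩
    rcases lt_trichotomy μ 0 with hμ | hμ | hμ
    · obtain ⟨q, hq⟩ := exists_rat_gt ((a + b) / (-μ))
      have h1 := h (max c q) (le_max_left _ _)
      have h2 : (q : ℝ) ≤ ((max c q : ℚ) : ℝ) := by exact_mod_cast le_max_right c q
      have h3 := (div_lt_iff₀ (neg_pos.2 hμ)).1 (hq.trans_le h2)
      linarith
    · refine Or.inr ⟨hμ, ?_⟩
      simpa [hμ] using h c le_rfl
    · exact Or.inl hμ
  · rintro (hμ | ⟨hμ, h⟩)
    · obtain ⟨q, hq⟩ := exists_rat_gt (-(a + b) / μ)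
      refine ⟨max q 1, by simp, fun δ hδ => ?_⟩
      have h2 : (q : ℝ) ≤ δ := by exact_mod_cast (le_max_left q 1).trans hδ
      have h3 := (div_lt_iff₀ hμ).1 (hq.trans_le h2)
      linarith
    · exact ⟨1, one_pos, fun δ _ => by simpa [hμ] using h⟩

lemma asymptotically_pos_iff (a μ b : ℝ) :
    (∃ c : ℚ, 0 < c ∧ ∀ δ : ℚ, c ≤ δ → 0 < a + (δ : ℝ) * μ + b) ↔
      0 < μ ∨ (μ = 0 ∧ 0 < a + b) := by
  constructor
  · rintro ⟨c, hc, h⟩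
    rcases (asymptotically_nonneg_iff a μ b).1 ⟨c, hc, fun δ hδ => (h δ hδ).le⟩ with hμ | ⟨hμ, -⟩
    · exact Or.inl hμ
    · refine Or.inr ⟨hμ, ?_⟩
      simpa [hμ] using h c le_rfl
  · rintro (hμ | ⟨hμ, h⟩)
    · obtain ⟨q, hq⟩ := exists_rat_gt (-(a + b) / μ)
      refine ⟨max q 1, by simp, fun δ hδ => ?_⟩
      have h2 : (q : ℝ) ≤ δ := by exact_mod_cast (le_max_left q 1).trans hδ
      have h3 := (div_lt_iff₀ hμ).1 (hq.trans_le h2)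
      linarith
    · exact ⟨1, one_pos, fun δ _ => by simpa [hμ] using h⟩

/-! ### The contribution of the parabolic structure -/

section Parabolic

variable {C : Curve} {x₀ : C.X} {L : VectorBundle C.X 1} {r : ℕ} {P : ParabolicType r}
  (H : HitchinPair C x₀ L P)

lemma WeightedFlag.rank_bundle_pos {X : Scheme.{0}} {r : ℕ} {E : VectorBundle X r}
    (A : WeightedFlag E) : 0 < r :=
  (A.rank_pos ⟨0, A.length_pos⟩).trans (A.rank_lt _)

lemma nontrivial_of_finrank_eq {K V : Type} [Field K] [AddCommGroup V] [Module K V]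
    {r : ℕ} (h : finrank K V = r) (hr : 0 < r) : Nontrivial V :=
  Module.nontrivial_of_finrank_pos (R := K) (h ▸ hr)

lemma Subbundle.fibre_mono {X : Scheme.{0}} {E : VectorBundle X r} {F G : Subbundle E} {x : X}
    (h : F.stalk x ≤ G.stalk x) : F.fibre x ≤ G.fibre x :=
  Submodule.baseChange_mono _ h

/-- The Plücker vector is a pure tensor of wedges of bases of the `V_i`, so its weight is the sum of
theirs. -/
lemma HitchinPair.mu2_associatedSwamp (T : TargetBundle C L) (A : WeightedFlag H.E) :
    (H.associatedSwamp T).mu2 A = ∑ i, (P.mult i : ℝ) * ∑ j, (A.weight j : ℝ) *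
      (((A.sub j).rank : ℝ) * P.dim i -
        r * finrank (Kappa x₀) (H.V i ⊓ (A.sub j).fibre x₀ : Submodule _ _)) := by
  have hfin := H.E.finite_fibre x₀
  have hnt : Nontrivial (Fibre H.E.sheaf x₀) :=
    nontrivial_of_finrank_eq (H.E.finrank_fibre x₀) A.rank_bundle_pos
  have hW : Monotone fun j => (A.sub j).fibre x₀ := fun j k hjk =>
    Subbundle.fibre_mono (A.stalk_mono x₀ hjk)
  have h : ∀ p : P.Index, _ := fun p : P.Index =>
    hasWeight_ιMulti_basis hW A.weight_pos (H.flagBasis p.1)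
  have h2 := (HasWeight.tprod h).mu_eval
  refine h2.trans ?_
  simp only [Subbundle.finrank_fibre, VectorBundle.finrank_fibre]
  exact P.sum_index fun i => ∑ j, (A.weight j : ℝ) * (((A.sub j).rank : ℝ) * P.dim i -
    r * finrank (Kappa x₀) (H.V i ⊓ (A.sub j).fibre x₀ : Submodule _ _))

/-- The parabolic weight of a weighted flag. -/
def HitchinPair.parabolicTerm (A : WeightedFlag H.E) : ℚ :=
  ∑ j, A.weight j * (H.pardeg (Subbundle.whole H.E) * (A.sub j).rank - H.pardeg (A.sub j) * r)

lemma HitchinPair.degreeTerm_add_mu2 (T : TargetBundle C L) (A : WeightedFlag H.E) :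
    (A.degreeTerm : ℝ) + ((1 / (P.z : ℚ) : ℚ) : ℝ) * (H.associatedSwamp T).mu2 A =
      (H.parabolicTerm A : ℝ) := by
  have hw : ∀ i, finrank (Kappa x₀)
      ((Subbundle.whole H.E).fibre x₀ ⊓ H.V i : Submodule _ _) = P.dim i := fun i => by
    have : (Subbundle.whole H.E).fibre x₀ = ⊤ := Submodule.baseChange_top _
    rw [this, top_inf_eq, H.finrank_V]
  have hmu : ((1 / (P.z : ℚ) : ℚ) : ℝ) * (H.associatedSwamp T).mu2 A =
      ((∑ j, A.weight j * ∑ i, P.weight i * (((A.sub j).rank : ℚ) * P.dim i -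
        r * finrank (Kappa x₀) ((A.sub j).fibre x₀ ⊓ H.V i : Submodule _ _)) : ℚ) : ℝ) := by
    rw [H.mu2_associatedSwamp T A]
    have hz : (P.z : ℚ) ≠ 0 := by exact_mod_cast P.z_ne_zero
    have h : ∀ i, ((1 / (P.z : ℚ) : ℚ) : ℝ) * (P.mult i : ℝ) = (P.weight i : ℝ) := fun i => by
      have : 1 / (P.z : ℚ) * P.mult i = P.weight i := by
        rw [P.mult_eq]
        field_simp
      exact_mod_cast congrArg (Rat.cast : ℚ → ℝ) this
    simp only [Finset.mul_sum, ← mul_assoc, h]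
    push_cast
    rw [Finset.sum_comm]
    refine Finset.sum_congr rfl fun j _ => Finset.sum_congr rfl fun i _ => ?_
    rw [inf_comm]
    ring
  rw [hmu, ← Rat.cast_add]
  congr 1
  rw [WeightedFlag.degreeTerm, HitchinPair.parabolicTerm, ← Finset.sum_add_distrib]
  refine Finset.sum_congr rfl fun j _ => ?_
  rw [← mul_add]
  congr 1
  simp only [HitchinPair.pardeg, hw, mul_sub, Finset.sum_sub_distrib, add_mul, Finset.sum_mul]
  have h1 : ∑ i, P.weight i * (((A.sub j).rank : ℚ) * P.dim i) =
      ∑ i, P.weight i * (P.dim i : ℚ) * (A.sub j).rank :=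
    Finset.sum_congr rfl fun i _ => by ring
  have h2 : ∑ i, P.weight i * ((r : ℚ) *
        finrank (Kappa x₀) ((A.sub j).fibre x₀ ⊓ H.V i : Submodule _ _)) =
      ∑ i, P.weight i * (finrank (Kappa x₀)
        ((A.sub j).fibre x₀ ⊓ H.V i : Submodule _ _) : ℚ) * r :=
    Finset.sum_congr rfl fun i _ => by ring
  rw [h1, h2]
  ring

end Parabolic

/-! ### Kernels of powers of a nilpotent endomorphism -/

section KernelFlag

variable {K V : Type} [Field K] [AddCommGroup V] [Module K V] {ψ : V →ₗ[K] V}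

lemma ker_pow_mono {i j : ℕ} (h : i ≤ j) : LinearMap.ker (ψ ^ i) ≤ LinearMap.ker (ψ ^ j) := by
  intro v hv
  rw [LinearMap.mem_ker] at hv ⊢
  rw [← Nat.sub_add_cancel h, pow_add, Module.End.mul_apply, hv, map_zero]

/-- If two of these kernels agreed, the chain would be constant from there on, contradicting
minimality of `k`. -/
lemma ker_pow_lt {k : ℕ} (hk : ψ ^ k = 0) (hmin : ∀ i < k, ψ ^ i ≠ 0) {i j : ℕ} (hij : i < j)
    (hj : j ≤ k) : LinearMap.ker (ψ ^ i) < LinearMap.ker (ψ ^ j) := by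
  refine lt_of_le_of_ne (ker_pow_mono hij.le) fun h => hmin i (hij.trans_le hj) ?_
  have h1 : LinearMap.ker (ψ ^ i) = LinearMap.ker (ψ ^ i.succ) :=
    le_antisymm (ker_pow_mono i.le_succ) ((ker_pow_mono hij).trans h.ge)
  have h2 := Module.End.ker_pow_constant h1 (k - i)
  rw [Nat.add_sub_cancel' (hij.le.trans hj), hk, LinearMap.ker_zero] at h2
  exact LinearMap.ker_eq_top.1 h2

lemma map_flagStep_ker_pow_le {m : ℕ} (hm : ψ ^ (m + 1) = 0) {W : Fin m → Submodule K V}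
    (hW : ∀ j, W j = LinearMap.ker (ψ ^ (j.val + 1))) (i : Fin (m + 1)) :
    (flagStep W i).map ψ ≤ flagBefore W i := by
  have h : ∀ i : Fin (m + 1), flagStep W i = LinearMap.ker (ψ ^ (i.val + 1)) := fun i => by
    induction i using Fin.lastCases with
    | last => simp [hm]
    | cast j => simp [hW]
  rintro _ ⟨v, hv, rfl⟩
  have hv' : (ψ ^ (i.val + 1)) v = 0 := by
    rw [h] at hv
    exact hv
  rw [pow_succ, Module.End.mul_apply] at hv'
  induction i using Fin.cases with
  | zero =>
    have : ψ v = 0 := hv'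
    rw [this]
    exact zero_mem _
  | succ j =>
    refine flagStep_le_flagBefore W (Fin.castSucc_lt_succ (i := j)) ?_
    rw [h]
    exact hv'

end KernelFlag

/-! ### From weights of flags to invariant subbundles and nilpotency -/

section Assembly

variable {C : Curve} {x₀ : C.X} {L : VectorBundle C.X 1} {r : ℕ} {P : ParabolicType r}
  (H : HitchinPair C x₀ L P) (T : TargetBundle C L)

/-- A generator of the generic stalk of a line bundle. -/
def genericGenerator {X : Scheme.{0}} [IsIntegral X] (L : VectorBundle X 1) :
    Basis (Fin 1) (X.presheaf.stalk (genericPoint X)) (Stalk L.sheaf (genericPoint X)) :=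
  (L.nonempty_basis (genericPoint X)).some

/-- The endomorphism of the generic stalk given by the Higgs field. -/
abbrev HitchinPair.genericEnd : Stalk H.E.sheaf (genericPoint C.X)
    →ₗ[C.X.presheaf.stalk (genericPoint C.X)] Stalk H.E.sheaf (genericPoint C.X) :=
  H.phi.localEnd (genericPoint C.X) (genericGenerator L)

/-- The value of the second component of the decoration at the generic point. -/
def HitchinPair.genericConstant : Stalk T.N.sheaf (genericPoint C.X) :=
  C.X.presheaf.germ ⊤ (genericPoint C.X) trivial (C.const H.eps) •
    germ T.N.sheaf (genericPoint C.X) (U := ⊤) trivial T.unitSection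

lemma HitchinPair.genericConstant_eq_zero_iff : H.genericConstant T = 0 ↔ H.eps = 0 := by
  constructor
  · intro h
    by_contra hne
    have hu : IsUnit (C.X.presheaf.germ ⊤ (genericPoint C.X) trivial (C.const H.eps)) :=
      ((IsUnit.mk0 _ hne).map C.const).map (C.X.presheaf.germ ⊤ (genericPoint C.X) trivial).hom
    exact T.germ_unitSection_ne_zero _ (hu.smul_eq_zero.1 h)
  · intro h
    rw [HitchinPair.genericConstant, h, map_zero, map_zero, zero_smul]

/-- Writing `φ(v) = ψ(v) ⊗ b` with `b` the generator of `L`, the decoration sends `ξ ⊗ v` to `ξ(ψ v)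
ι₁(b)`, and `ι₁(b) ≠ 0` since `ι₁` is mono. -/
lemma HitchinPair.isEndFunctional : IsEndFunctional (K := C.X.functionField)
    (V := Stalk H.E.sheaf (genericPoint C.X)) (N := Stalk T.N.sheaf (genericPoint C.X))
    H.genericEnd (stalkMap T.ι₁ (genericPoint C.X) (genericGenerator L 0))
    (H.genericConstant T) (H.globalDecoration T (genericPoint C.X)) where
  apply_tmul ξ v := by
    refine (H.globalDecoration_tmul T _ ξ v).trans ?_
    rw [H.phi.map_eq _ (genericGenerator L), LinearMap.rTensor_tmul, TensorProduct.lid_tmul,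
      map_smul]
  apply_one := H.globalDecoration_one T _
  ne_zero h := by
    have := T.mono_ι₁
    have h1 := stalkMap_injective T.ι₁ _ (h.trans (map_zero _).symm)
    exact (genericGenerator L).ne_zero 0 h1

lemma HitchinPair.mu1_associatedSwamp (A : WeightedFlag H.E) :
    (H.associatedSwamp T).mu1 A = endMu (K := C.X.functionField)
      (fun j => (A.sub j).stalk (genericPoint C.X)) A.weight
      (H.globalDecoration T (genericPoint C.X)) := rfl

lemma HitchinPair.finite_genericStalk :
    FiniteDimensional C.X.functionField (Stalk H.E.sheaf (genericPoint C.X)) :=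
  H.E.finite_stalk _

lemma HitchinPair.nontrivial_genericStalk (hr : 0 < r) :
    Nontrivial (Stalk H.E.sheaf (genericPoint C.X)) :=
  nontrivial_of_finrank_eq (K := C.X.functionField) (H.E.finrank_stalk _) hr

lemma HitchinPair.mu1_nonpos (A : WeightedFlag H.E) (hA : ∀ j, (A.sub j).IsInvariant H.phi) :
    (H.associatedSwamp T).mu1 A ≤ 0 := by
  have := H.finite_genericStalk
  have := H.nontrivial_genericStalk A.rank_bundle_pos
  rw [H.mu1_associatedSwamp]
  exact mu_endFiltration_nonpos A.weight_pos (H.isEndFunctional T)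
    fun j v hv => ((A.sub j).isInvariant_iff H.phi (genericGenerator L)).1 (hA j) v hv

lemma HitchinPair.isInvariant_of_mu1_nonpos (A : WeightedFlag H.E)
    (h : (H.associatedSwamp T).mu1 A ≤ 0) (j : Fin A.length) : (A.sub j).IsInvariant H.phi := by
  have := H.finite_genericStalk
  have := H.nontrivial_genericStalk A.rank_bundle_pos
  rw [H.mu1_associatedSwamp] at h
  exact ((A.sub j).isInvariant_iff H.phi (genericGenerator L)).2 fun v hv =>
    invariant_of_mu_endFiltration_nonpos (A.stalk_mono _) A.weight_pos (H.isEndFunctional T) h j v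
      hv

lemma HitchinPair.nilpotent_of_mu1_neg (A : WeightedFlag H.E)
    (h : (H.associatedSwamp T).mu1 A < 0) : H.eps = 0 ∧ H.phi.IsNilpotent := by
  have := H.finite_genericStalk
  have := H.nontrivial_genericStalk A.rank_bundle_pos
  rw [H.mu1_associatedSwamp] at h
  obtain ⟨h1, h2⟩ := flagBefore_of_mu_endFiltration_neg A.weight_pos (H.isEndFunctional T) h
  exact ⟨(H.genericConstant_eq_zero_iff T).1 h1,
    (H.phi.isNilpotent_iff (genericGenerator L)).2 ⟨_, pow_eq_zero_of_flagBefore h2⟩⟩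

/-- A subbundle as a one-step weighted flag of weight one. -/
def Subbundle.toFlag {X : Scheme.{0}} {E : VectorBundle X r} (F : Subbundle E) (h₀ : 0 < F.rank)
    (h₁ : F.rank < r) : WeightedFlag E where
  length := 1
  length_pos := one_pos
  sub _ := F
  rank_pos _ := h₀
  rank_lt _ := h₁
  rank_strictMono := Subsingleton.strictMono _
  stalk_mono _ := monotone_const
  weight _ := 1
  weight_pos _ := one_pos

lemma HitchinPair.parabolicTerm_toFlag (F : Subbundle H.E) (h₀ : 0 < F.rank) (h₁ : F.rank < r) :
    H.parabolicTerm (F.toFlag h₀ h₁) =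
      H.pardeg (Subbundle.whole H.E) * F.rank - H.pardeg F * r := by
  refine (Fin.sum_univ_one _).trans ?_
  exact one_mul _

lemma saturatedStalk_mono {X : Scheme.{0}} [IsIntegral X] {E : VectorBundle X r}
    {W W' : Submodule (X.presheaf.stalk (genericPoint X)) (Stalk E.sheaf (genericPoint X))}
    (h : W ≤ W') (x : X) : saturatedStalk E W x ≤ saturatedStalk E W' x :=
  fun _ hs => h hs

/-- The destabilizing flag consists of the saturated kernels of the powers of `ψ`, each of which `ψ`
maps into the previous one; any positive weights would do. -/
lemma HitchinPair.exists_mu1_neg (hε : H.eps = 0) (hnil : H.phi.IsNilpotent) :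
    ∃ A : WeightedFlag H.E, (H.associatedSwamp T).mu1 A < 0 := by
  classical
  have hfin := H.finite_genericStalk
  have hψ : H.genericEnd ≠ 0 := fun h => by
    rcases H.nontrivial with ⟨x, hx⟩ | h'
    · exact hx (H.phi.localEnd_genericPoint_eq_zero _ h x)
    · exact h' hε
  have hnil' := (H.phi.isNilpotent_iff (genericGenerator L)).1 hnil
  obtain ⟨k, hk, hmin⟩ : ∃ k, H.genericEnd ^ k = 0 ∧ ∀ i < k, H.genericEnd ^ i ≠ 0 :=
    ⟨Nat.find hnil', Nat.find_spec hnil', fun i hi => Nat.find_min hnil' hi⟩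
  -- As `ψ ≠ 0`, the nilpotency order is at least two, so the flag of the `m + 1` proper kernels is
  -- nonempty.
  obtain ⟨m, rfl⟩ : ∃ m, k = m + 2 := by
    match k, hk with
    | 0, hk =>
      refine absurd (LinearMap.ext fun v => ?_) hψ
      have := LinearMap.congr_fun hk (H.genericEnd v)
      simpa using this
    | 1, hk => exact absurd ((pow_one _).symm.trans hk) hψ
    | m + 2, _ => exact ⟨m, rfl⟩
  let W : ℕ → Submodule (C.X.presheaf.stalk (genericPoint C.X))
    (Stalk H.E.sheaf (genericPoint C.X)) := fun i => LinearMap.ker (H.genericEnd ^ i)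
  have hlt : ∀ {i j}, i < j → j ≤ m + 2 →
      finrank (C.X.presheaf.stalk (genericPoint C.X)) (W i) <
        finrank (C.X.presheaf.stalk (genericPoint C.X)) (W j) := fun hij hj =>
    Submodule.finrank_lt_finrank_of_lt (K := C.X.functionField)
      (ker_pow_lt (K := C.X.functionField) hk hmin hij hj)
  have htop : finrank (C.X.presheaf.stalk (genericPoint C.X)) (W (m + 2)) = r := by
    have : W (m + 2) = ⊤ := by simp only [W, hk, LinearMap.ker_zero]
    rw [this, finrank_top, H.E.finrank_stalk]
  let A : WeightedFlag H.E :=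
    { length := m + 1
      length_pos := m.succ_pos
      sub := fun j => saturation (W (j.val + 1)) (isPrincipalIdealRing_stalk C)
      rank_pos := fun j => (Nat.zero_le _).trans_lt (hlt (Nat.succ_pos j.val) (by omega))
      rank_lt := fun j => (hlt (j := m + 2) (by omega) le_rfl).trans_eq htop
      rank_strictMono := fun i j hij => hlt (Nat.succ_lt_succ hij) (by omega)
      stalk_mono := fun x i j hij => saturatedStalk_mono
        (ker_pow_mono (K := C.X.functionField) (Nat.succ_le_succ hij)) x
      weight := fun _ => 1
      weight_pos := fun _ => one_pos }
  have := H.nontrivial_genericStalk A.rank_bundle_pos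
  refine ⟨A, ?_⟩
  rw [H.mu1_associatedSwamp]
  have hΦ := H.isEndFunctional T
  rw [(H.genericConstant_eq_zero_iff T).2 hε] at hΦ
  refine mu_endFiltration_neg A.weight_pos hΦ hψ fun i => ?_
  exact map_flagStep_ker_pow_le (K := C.X.functionField) (m := m + 1) hk
    (W := fun j => (A.sub j).stalk (genericPoint C.X))
    (fun j => saturation_stalk_genericPoint (isPrincipalIdealRing_stalk C)) i

lemma HitchinPair.isSemistable_iff : H.IsSemistable T ↔ ∀ A : WeightedFlag H.E,
    0 < (H.associatedSwamp T).mu1 A ∨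
      ((H.associatedSwamp T).mu1 A = 0 ∧ 0 ≤ H.parabolicTerm A) := by
  refine forall_congr' fun A => (asymptotically_nonneg_iff _ _ _).trans
    (or_congr Iff.rfl (and_congr Iff.rfl ?_))
  exact (iff_of_eq (congrArg (0 ≤ ·) (H.degreeTerm_add_mu2 T A))).trans Rat.cast_nonneg

lemma HitchinPair.isStable_iff : H.IsStable T ↔ ∀ A : WeightedFlag H.E,
    0 < (H.associatedSwamp T).mu1 A ∨
      ((H.associatedSwamp T).mu1 A = 0 ∧ 0 < H.parabolicTerm A) := by
  refine forall_congr' fun A => (asymptotically_pos_iff _ _ _).trans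
    (or_congr Iff.rfl (and_congr Iff.rfl ?_))
  exact (iff_of_eq (congrArg (0 < ·) (H.degreeTerm_add_mu2 T A))).trans Rat.cast_pos

/-- If a property of weighted flags amounts to a property of each member, then its validity for all
flags of weight zero, together with the absence of flags of negative weight, means the absence of
nilpotent Higgs fields together with its validity for all invariant subbundles. -/
lemma HitchinPair.forall_flag_iff (p : WeightedFlag H.E → Prop) (q : Subbundle H.E → Prop)
    (hpq : ∀ A : WeightedFlag H.E, (∀ j, q (A.sub j)) → p A)
    (hqp : ∀ (F : Subbundle H.E) (h₀ : 0 < F.rank) (h₁ : F.rank < r), p (F.toFlag h₀ h₁) → q F) :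
    (∀ A : WeightedFlag H.E, 0 < (H.associatedSwamp T).mu1 A ∨
      ((H.associatedSwamp T).mu1 A = 0 ∧ p A)) ↔
    (H.eps = 0 → ¬ H.phi.IsNilpotent) ∧
      ∀ F : Subbundle H.E, 0 < F.rank → F.rank < r → F.IsInvariant H.phi → q F := by
  constructor
  · refine fun h => ⟨fun hε hnil => ?_, fun F h₀ h₁ hF => ?_⟩
    · obtain ⟨A, hA⟩ := H.exists_mu1_neg T hε hnil
      rcases h A with h1 | ⟨h1, -⟩ <;> linarith
    -- Invariance excludes positive `μ₁` for the one-step flag, so the second alternative must hold.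
    · have h1 := H.mu1_nonpos T (F.toFlag h₀ h₁) fun _ => hF
      rcases h (F.toFlag h₀ h₁) with h2 | ⟨-, h2⟩
      · exact absurd h2 h1.not_gt
      · exact hqp F h₀ h₁ h2
  · rintro ⟨h1, h2⟩ A
    rcases lt_trichotomy ((H.associatedSwamp T).mu1 A) 0 with h | h | h
    -- Negative `μ₁` would contradict the first condition.
    · obtain ⟨hε, hnil⟩ := H.nilpotent_of_mu1_neg T A h
      exact absurd hnil (h1 hε)
    · exact Or.inr ⟨h, hpq A fun j => h2 _ (A.rank_pos j) (A.rank_lt j)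
        (H.isInvariant_of_mu1_nonpos T A h.le j)⟩
    · exact Or.inl h

end Assembly

end

end ParHitchin

theorem proposition5p4 (C : ParHitchin.Curve) (x₀ : C.X) (hx₀ : IsClosed ({x₀} : Set C.X))
    (L : ParHitchin.VectorBundle C.X 1) (T : ParHitchin.TargetBundle C L)
    (r : ℕ) (P : ParHitchin.ParabolicType r) (H : ParHitchin.HitchinPair C x₀ L P) :
    (H.IsSemistable T ↔
      (H.eps = 0 → ¬ H.phi.IsNilpotent) ∧
      ∀ F : ParHitchin.Subbundle H.E, 0 < F.rank → F.rank < r → F.IsInvariant H.phi →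
        H.pardeg F / (F.rank : ℚ) ≤ H.pardeg (ParHitchin.Subbundle.whole H.E) / (r : ℚ)) ∧
    (H.IsStable T ↔
      (H.eps = 0 → ¬ H.phi.IsNilpotent) ∧
      ∀ F : ParHitchin.Subbundle H.E, 0 < F.rank → F.rank < r → F.IsInvariant H.phi →
        H.pardeg F / (F.rank : ℚ) < H.pardeg (ParHitchin.Subbundle.whole H.E) / (r : ℚ)) := by
  have hr : ∀ {s : ℕ}, s < r → (0 : ℚ) < r := fun h => by
    exact_mod_cast (Nat.zero_le _).trans_lt h
  have hs : ∀ {s : ℕ}, 0 < s → (0 : ℚ) < s := fun h => by exact_mod_cast h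
  constructor
  · rw [H.isSemistable_iff T]
    refine H.forall_flag_iff T _ _ (fun A h => ?_) fun F h₀ h₁ h => ?_
    · refine Finset.sum_nonneg fun j _ => mul_nonneg (A.weight_pos j).le (sub_nonneg.2 ?_)
      exact (div_le_div_iff₀ (hs (A.rank_pos j)) (hr (A.rank_lt j))).1 (h j)
    · rw [H.parabolicTerm_toFlag, sub_nonneg] at h
      exact (div_le_div_iff₀ (hs h₀) (hr h₁)).2 h
  · rw [H.isStable_iff T]
    refine H.forall_flag_iff T _ _ (fun A h => ?_) fun F h₀ h₁ h => ?_
    -- Strictness survives summation because weighted flags are nonempty.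
    · refine Finset.sum_pos (fun j _ => mul_pos (A.weight_pos j) (sub_pos.2 ?_))
        ⟨⟨0, A.length_pos⟩, Finset.mem_univ _⟩
      exact (div_lt_div_iff₀ (hs (A.rank_pos j)) (hr (A.rank_lt j))).1 (h j)
    · rw [H.parabolicTerm_toFlag, sub_pos] at h
      exact (div_lt_div_iff₀ (hs h₀) (hr h₁)).2 h
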